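/- Conventions. A polynomial automorphism of $\mathbb{C}^2$ is a polynomial map $\varphi=(\varphi_0,\varphi_1)\colon\mathbb{C}^2\to\mathbb{C}^2$ in the coordinates $(z_0,z_1)$ that has a polynomial inverse; these form the group $\mathrm{Aut}(\mathbb{C}^2)$, and the degree of $\varphi$ is $\max(\deg\varphi_0,\deg\varphi_1)$. Let $\mathrm{Bir}(\mathbb{P}^2_{\mathbb{C}})$ be the group of birational self maps of $\mathbb{P}^2_{\mathbb{C}}$. The groups $\mathrm{Aut}(\mathbb{P}^2_{\mathbb{C}})=\mathrm{PGL}(3,\mathbb{C})$ and, through the chart $(z_0,z_1)\mapsto(z_0:z_1:1)$, $\mathrm{Aut}(\mathbb{C}^2)$ are regarded as subgroups of $\mathrm{Bir}(\mathbb{P}^2_{\mathbb{C}})$. Let $\mathrm{J}_2=\mathrm{PGL}(2,\mathbb{C}(z_1))\rtimes\mathrm{PGL}(2,\mathbb{C})\subset\mathrm{Bir}(\mathbb{P}^2_{\mathbb{C}})$ be the group of the maps $$(z_0,z_1)\dashrightarrow\left(\frac{a(z_1)z_0+b(z_1)}{c(z_1)z_0+d(z_1)},\ \frac{\alpha z_1+\beta}{\gamma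 z_1+\delta}\right),\qquad a,b,c,d\in\mathbb{C}(z_1),\ \alpha,\beta,\gamma,\delta\in\mathbb{C},\ ad-bc\neq0,\ \alpha\delta-\beta\gamma\neq0.$$ For $\mathrm{H}\subset\mathrm{Bir}(\mathbb{P}^2_{\mathbb{C}})$ a subgroup, $\mathfrak{n}(\varphi,\mathrm{H})$ denotes the minimal number of involutions (elements of order $2$) of $\mathrm{H}$ whose composition is $\varphi$; it is $0$ for the identity, and $+\infty$ if $\varphi$ is not a composition of involutions of $\mathrm{H}$. An automorphism $\varphi\in\mathrm{Aut}(\mathbb{C}^2)$ is affine if $\varphi(z)=Az+b$ with $A\in\mathrm{GL}(2,\mathbb{C})$ and $b\in\mathbb{C}^2$; it is elementary if $\varphi_1$ depends only on $z_1$; it is a generalized Hénon map if $\varphi=(z_1,\,P(z_1)-\delta z_0)$ with $\delta\in\mathbb{C}^*$ and $P\in\mathbb{C}[z_1]$ of degree $\geq2$ (its jacobian is then $\delta$). Theorem. Let $\varphi\in\mathrm{Aut}(\mathbb{C}^2)$ be of degree $d$. Then $$\mathfrak{n}\big(\varphi,\mathrm{Bir}(\mathbb{P}^2_{\mathbb{C}})\big)\leq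 44+\frac{9d}{4}.$$ More precisely: - if $\varphi$ is affine, then $\mathfrak{n}\big(\varphi,\mathrm{Aut}(\mathbb{P}^2_{\mathbb{C}})\big)\leq 8$; - if $\varphi$ is elementary, then $\mathfrak{n}\big(\varphi,\mathrm{J}_2\big)\leq 10$; - if $\varphi$ is a generalized Hénon map, then $\mathfrak{n}\big(\varphi,\mathrm{Aut}(\mathbb{C}^2)\big)=2$ when its jacobian is $1$, and $\mathfrak{n}\big(\varphi,\mathrm{Bir}(\mathbb{P}^2_{\mathbb{C}})\big)\leq 11$ otherwise; - if $d$ is prime, then $\mathfrak{n}\big(\varphi,\mathrm{Bir}(\mathbb{P}^2_{\mathbb{C}})\big)\leq 26$. -/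

import Mathlib

open MvPolynomial

/-! ### Rational self maps of the projective plane -/

/-- A triple `(F 0 : F 1 : F 2)` of homogeneous polynomials of the same degree that defines a
dominant rational self map of the complex projective plane: no plane curve contains its image.
Common factors are allowed here; they disappear in the quotient `DominantMap`. -/
structure DominantTriple where
  F : Fin 3 → MvPolynomial (Fin 3) ℂ
  deg : ℕ
  homog : ∀ i, (F i).IsHomogeneous deg
  dominant : ∀ (p : MvPolynomial (Fin 3) ℂ) (k : ℕ), p.IsHomogeneous k → bind₁ F p = 0 → p = 0

namespace DominantTriple

theorem ne_zero (S : DominantTriple) (i : Fin 3) : S.F i ≠ 0 := fun h =>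
  X_ne_zero (R := ℂ) i (S.dominant (X i) 1 (isHomogeneous_X ℂ i) (by simpa using h))

theorem aeval_mul_left {A : Type*} [CommRing A] [Algebra ℂ A] {F : Fin 3 → A} (c : A)
    {p : MvPolynomial (Fin 3) ℂ} {k : ℕ} (hp : p.IsHomogeneous k) :
    aeval (fun i => c * F i) p = c ^ k * aeval F p := by
  simp only [aeval_def, eval₂_eq, Finset.mul_sum]
  refine Finset.sum_congr rfl fun m hm => ?_
  have h : ∑ i ∈ m.support, m i = k := by
    have := hp (mem_support_iff.mp hm)
    simpa [Finsupp.weight_apply, Finsupp.sum] using this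
  simp only [mul_pow, Finset.prod_mul_distrib, Finset.prod_pow_eq_pow_sum, h]
  ring

theorem bind₁_mul_left {F : Fin 3 → MvPolynomial (Fin 3) ℂ} (c : MvPolynomial (Fin 3) ℂ)
    {p : MvPolynomial (Fin 3) ℂ} {k : ℕ} (hp : p.IsHomogeneous k) :
    bind₁ (fun i => c * F i) p = c ^ k * bind₁ F p := aeval_mul_left c hp

/-- Two triples define the same rational map when they are proportional. -/
instance setoid : Setoid DominantTriple where
  r S T := ∀ i j, S.F i * T.F j = S.F j * T.F i
  iseqv :=
    { refl := fun S i j => mul_comm _ _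
      symm := fun h i j => by rw [mul_comm, ← h, mul_comm]
      trans := fun {S T U} h h' i j => by
        apply mul_right_cancel₀ (T.ne_zero i)
        linear_combination U.F i * h i j + S.F i * h' i j }

theorem equiv_def {S T : DominantTriple} :
    S ≈ T ↔ ∀ i j, S.F i * T.F j = S.F j * T.F i := Iff.rfl

/-- The identity `(z₀ : z₁ : z₂)`. -/
noncomputable def id : DominantTriple where
  F := X
  deg := 1
  homog := isHomogeneous_X ℂ
  dominant p _ _ h := by simpa using h

/-- The composition `S ∘ T`: substitute the components of `T` for the variables of `S`. -/
noncomputable def comp (S T : DominantTriple) : DominantTriple where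
  F i := bind₁ T.F (S.F i)
  deg := T.deg * S.deg
  homog i := (S.homog i).aeval T.F T.homog
  dominant p k hp h := by
    refine S.dominant p k hp (T.dominant _ _ (hp.aeval S.F S.homog) ?_)
    rw [← h]
    exact (bind₁_bind₁ _ _ _)

theorem comp_congr {S S' T T' : DominantTriple} (hS : S ≈ S') (hT : T ≈ T') :
    S.comp T ≈ S'.comp T' := by
  refine Setoid.trans (b := S'.comp T) ?_ ?_
  · intro i j
    have := congrArg (bind₁ T.F) (hS i j)
    simpa only [map_mul, comp] using this
  · have key : ∀ i, T'.F 0 ^ S'.deg * bind₁ T.F (S'.F i) = T.F 0 ^ S'.deg * bind₁ T'.F (S'.F i) := by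
      intro i
      rw [← bind₁_mul_left _ (S'.homog i), ← bind₁_mul_left _ (S'.homog i)]
      congr 2
      funext l
      linear_combination hT l 0
    intro i j
    simp only [comp]
    apply mul_left_cancel₀ (pow_ne_zero S'.deg (T'.ne_zero 0))
    linear_combination bind₁ T'.F (S'.F j) * key i - bind₁ T'.F (S'.F i) * key j

end DominantTriple

/-- Dominant rational self maps of the complex projective plane. -/
def DominantMap : Type := Quotient DominantTriple.setoid

/-- Dominant rational maps form a monoid under composition: `Φ * Ψ = Φ ∘ Ψ`. -/
noncomputable instance : Monoid DominantMap where
  mul := Quotient.map₂ DominantTriple.comp fun _ _ hS _ _ hT => DominantTriple.comp_congr hS hT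
  one := Quotient.mk _ DominantTriple.id
  mul_assoc := by
    rintro ⟨S⟩ ⟨T⟩ ⟨U⟩
    refine Quotient.sound fun i j => ?_
    simp only [DominantTriple.comp, bind₁_bind₁]
    exact mul_comm _ _
  one_mul := by
    rintro ⟨S⟩
    refine Quotient.sound fun i j => ?_
    simp only [DominantTriple.comp, DominantTriple.id, bind₁_X_right]
    exact mul_comm _ _
  mul_one := by
    rintro ⟨S⟩
    refine Quotient.sound fun i j => ?_
    simp only [DominantTriple.comp, DominantTriple.id, bind₁, aeval_X_left, AlgHom.coe_id, id_eq]
    exact mul_comm _ _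

/-- The Cremona group `Bir(ℙ²)`: the rational self maps of the complex projective plane with a
rational inverse. (If `F ∘ G` and `G ∘ F` are proportional to the identity, then `F` and `G` are
dominant, so that it does no harm to ask for this from the start.) -/
abbrev BirP2 : Type := DominantMapˣ

/-! ### Projective automorphisms -/

/-- The triple of linear forms with matrix `A`. -/
noncomputable def linearTriple (A : GL (Fin 3) ℂ) : DominantTriple where
  F i := ∑ j, C (A.1 i j) * X j
  deg := 1
  homog i := IsHomogeneous.sum _ _ _ fun j _ => by
    simpa using (isHomogeneous_C (Fin 3) (A.1 i j)).mul (isHomogeneous_X ℂ j)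
  dominant p k _ h := by
    have h2 := congrArg (bind₁ fun i => ∑ j, C ((A⁻¹).1 i j) * X j) h
    rw [bind₁_bind₁, map_zero] at h2
    have h3 : (fun i => bind₁ (fun i => ∑ j, C ((A⁻¹).1 i j) * X (R := ℂ) j)
        (∑ j, C (A.1 i j) * X j)) = X := by
      funext i
      have hA : A.1 * (A⁻¹).1 = 1 := by rw [← Units.val_mul, mul_inv_cancel, Units.val_one]
      simp only [map_sum, map_mul, bind₁_C_right, bind₁_X_right, Finset.mul_sum]
      rw [Finset.sum_comm]
      have : ∀ l : Fin 3, ∑ j, C (A.1 i j) * (C ((A⁻¹).1 j l) * X (R := ℂ) l)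
          = C ((1 : Matrix (Fin 3) (Fin 3) ℂ) i l) * X l := by
        intro l
        rw [← hA, Matrix.mul_apply, map_sum, Finset.sum_mul]
        exact Finset.sum_congr rfl fun j _ => by rw [map_mul]; ring
      rw [Finset.sum_congr rfl fun l _ => this l]
      simp [Matrix.one_apply, apply_ite C, ite_mul]
    rw [h3] at h2
    simpa using h2

/-- The action of `GL(3, ℂ)` on the projective plane. -/
noncomputable def linearMap : GL (Fin 3) ℂ →* BirP2 :=
  MonoidHom.toHomUnits
    { toFun := fun A => (Quotient.mk _ (linearTriple A) : DominantMap)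
      map_one' := by
        refine Quotient.sound fun i j => ?_
        simp [linearTriple, DominantTriple.id, Matrix.one_apply, apply_ite C, mul_comm]
      map_mul' := fun A B => by
        refine Quotient.sound fun i j => ?_
        have : ∀ i, ((linearTriple A).comp (linearTriple B)).F i = (linearTriple (A * B)).F i := by
          intro i
          simp only [linearTriple, DominantTriple.comp, map_sum, map_mul, bind₁_C_right,
            bind₁_X_right, Finset.mul_sum, Units.val_mul, Matrix.mul_apply, Finset.sum_mul]
          rw [Finset.sum_comm]
          exact Finset.sum_congr rfl fun l _ => Finset.sum_congr rfl fun j _ => by ring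
        rw [this, this, mul_comm] }

/-- `Aut(ℙ²) = PGL(3, ℂ)` as a subgroup of `Bir(ℙ²)`. -/
noncomputable def AutP2 : Subgroup BirP2 := linearMap.range

/-! ### The affine chart `(z₀, z₁) ↦ (z₀ : z₁ : 1)` -/

/-- Restriction of a polynomial in `z₀, z₁, z₂` to the plane `z₂ = 1`. -/
noncomputable def dehom : MvPolynomial (Fin 3) ℂ →ₐ[ℂ] MvPolynomial (Fin 2) ℂ :=
  aeval ![X 0, X 1, 1]

theorem dehom_eq_zero {p : MvPolynomial (Fin 3) ℂ} {k : ℕ} (hp : p.IsHomogeneous k)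
    (h : dehom p = 0) : p = 0 := by
  have h0 : X 2 * p = 0 := by
    refine MvPolynomial.funext fun x => ?_
    rw [map_mul, eval_X, map_zero]
    by_cases hx : x 2 = 0
    · rw [hx, zero_mul]
    have h1 : aeval ![x 0 / x 2, x 1 / x 2, 1] p = 0 := by
      have h2 := congrArg (aeval ![x 0 / x 2, x 1 / x 2]) h
      rw [map_zero, dehom, comp_aeval_apply] at h2
      rw [← h2]
      congr 2
      funext i
      fin_cases i <;> simp
    have h3 := DominantTriple.aeval_mul_left (F := ![x 0 / x 2, x 1 / x 2, 1]) (x 2) hp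
    have h4 : (fun i => x 2 * (![x 0 / x 2, x 1 / x 2, 1] : Fin 3 → ℂ) i) = x := by
      funext i
      fin_cases i
      · exact mul_div_cancel₀ _ hx
      · exact mul_div_cancel₀ _ hx
      · exact mul_one _
    rw [h1, h4, mul_zero, aeval_eq_eval] at h3
    exact mul_eq_zero_of_right _ h3
  exact (mul_eq_zero.mp h0).resolve_left (X_ne_zero 2)

/-- The homogeneous polynomial `z₂ ^ d * f (z₀ / z₂, z₁ / z₂)`, for `d` at least the degree
of `f`. -/
noncomputable def homogenize (d : ℕ) (f : MvPolynomial (Fin 2) ℂ) : MvPolynomial (Fin 3) ℂ :=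
  ∑ k ∈ Finset.range (d + 1), rename Fin.castSucc (homogeneousComponent k f) * X 2 ^ (d - k)

theorem homogenize_isHomogeneous (d : ℕ) (f : MvPolynomial (Fin 2) ℂ) :
    (homogenize d f).IsHomogeneous d := by
  refine IsHomogeneous.sum _ _ _ fun k hk => ?_
  have h := ((homogeneousComponent_isHomogeneous k f).rename_isHomogeneous
    (f := Fin.castSucc)).mul ((isHomogeneous_X ℂ (2 : Fin 3)).pow (d - k))
  have e : k + 1 * (d - k) = d := by have := Finset.mem_range.mp hk; omega
  rwa [e] at h

theorem dehom_homogenize {d : ℕ} {f : MvPolynomial (Fin 2) ℂ} (hf : f.totalDegree ≤ d) :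
    dehom (homogenize d f) = f := by
  have h1 : ∀ g : MvPolynomial (Fin 2) ℂ, dehom (rename Fin.castSucc g) = g := by
    intro g
    rw [dehom, aeval_rename]
    convert aeval_X_left_apply g using 2
    congr 1
    funext i
    fin_cases i <;> simp
  have h2 : dehom (X 2) = 1 := by simp [dehom]
  simp only [homogenize, map_sum, map_mul, map_pow, h1, h2, one_pow, mul_one]
  conv_rhs => rw [← sum_homogeneousComponent f]
  refine (Finset.sum_subset (Finset.range_mono (by omega)) fun k _ hk => ?_).symm
  exact homogeneousComponent_eq_zero _ _ (by simpa using hk)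

/-! ### Polynomial automorphisms of the affine plane -/

/-- A polynomial map `(z₀, z₁) ↦ (f 0 (z₀, z₁), f 1 (z₀, z₁))` of `ℂ²`. -/
@[ext]
structure PolyMap where
  f : Fin 2 → MvPolynomial (Fin 2) ℂ

namespace PolyMap

/-- Polynomial maps form a monoid under composition: `φ * ψ = φ ∘ ψ`. -/
noncomputable instance : Monoid PolyMap where
  mul φ ψ := ⟨fun i => bind₁ ψ.f (φ.f i)⟩
  one := ⟨X⟩
  mul_assoc φ ψ χ := PolyMap.ext (funext fun i => bind₁_bind₁ _ _ _)
  one_mul φ := PolyMap.ext (funext fun i => bind₁_X_right _ _)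
  mul_one φ := PolyMap.ext (funext fun i => aeval_X_left_apply _)

theorem mul_f (φ ψ : PolyMap) (i : Fin 2) : (φ * ψ).f i = bind₁ ψ.f (φ.f i) := rfl

theorem one_f : (1 : PolyMap).f = X := rfl

/-- The degree: the larger of the total degrees of the two components. -/
noncomputable def degree (φ : PolyMap) : ℕ := max (φ.f 0).totalDegree (φ.f 1).totalDegree

/-- The jacobian determinant. -/
noncomputable def jac (φ : PolyMap) : MvPolynomial (Fin 2) ℂ :=
  (Matrix.of fun i j => pderiv j (φ.f i)).det

end PolyMap

/-- The group `Aut(ℂ²)` of polynomial automorphisms: polynomial maps with a polynomial inverse. -/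
abbrev AutC2 : Type := PolyMapˣ

/-- The components of the homogenization of a polynomial map `φ = (f₀, f₁)` of degree `d`:
`(z₂ᵈ f₀(z₀/z₂, z₁/z₂) : z₂ᵈ f₁(z₀/z₂, z₁/z₂) : z₂ᵈ)`. -/
noncomputable def PolyMap.homog (φ : PolyMap) : Fin 3 → MvPolynomial (Fin 3) ℂ :=
  ![homogenize φ.degree (φ.f 0), homogenize φ.degree (φ.f 1), X 2 ^ φ.degree]

theorem PolyMap.dehom_homog (φ : PolyMap) :
    (fun i => dehom (φ.homog i)) = ![φ.f 0, φ.f 1, 1] := by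
  funext i
  fin_cases i
  · exact dehom_homogenize (le_max_left _ _)
  · exact dehom_homogenize (le_max_right _ _)
  · simp [PolyMap.homog, dehom]

theorem PolyMap.dehom_bind₁_homog (φ : PolyMap) (p : MvPolynomial (Fin 3) ℂ) :
    dehom (bind₁ φ.homog p) = bind₁ φ.f (dehom p) := by
  rw [bind₁, comp_aeval_apply, φ.dehom_homog, bind₁, dehom, comp_aeval_apply]
  congr 2
  funext i
  fin_cases i <;> simp

/-- The dominant rational map of the plane that extends a polynomial automorphism. -/
noncomputable def projTriple (φ : AutC2) : DominantTriple where
  F := φ.1.homog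
  deg := φ.1.degree
  homog i := by
    fin_cases i
    · exact homogenize_isHomogeneous _ _
    · exact homogenize_isHomogeneous _ _
    · simpa [PolyMap.homog] using (isHomogeneous_X ℂ (2 : Fin 3)).pow φ.1.degree
  dominant p k hp h := by
    apply dehom_eq_zero hp
    have h1 := congrArg dehom h
    rw [PolyMap.dehom_bind₁_homog, map_zero] at h1
    have h2 := congrArg (bind₁ (φ⁻¹).1.f) h1
    rw [bind₁_bind₁, map_zero] at h2
    have h3 : (fun i => bind₁ (φ⁻¹).1.f (φ.1.f i)) = X := by
      funext i
      rw [← PolyMap.mul_f, ← Units.val_mul, mul_inv_cancel, Units.val_one, PolyMap.one_f]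
    rw [h3] at h2
    simpa using h2

theorem DominantTriple.equiv_of_dehom {S T : DominantTriple}
    (h : ∀ i, dehom (S.F i) = dehom (T.F i)) : S ≈ T := by
  intro i j
  have h1 : (S.F j * T.F i).IsHomogeneous (S.deg + T.deg) := (S.homog j).mul (T.homog i)
  apply sub_eq_zero.mp
  refine dehom_eq_zero (((S.homog i).mul (T.homog j)).sub h1) ?_
  rw [map_sub, map_mul, map_mul, h i, h j, mul_comm, sub_self]

/-- The inclusion of `Aut(ℂ²)` in `Bir(ℙ²)`, through the chart `(z₀, z₁) ↦ (z₀ : z₁ : 1)`. -/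
noncomputable def toBir : AutC2 →* BirP2 :=
  MonoidHom.toHomUnits
    { toFun := fun φ => (Quotient.mk _ (projTriple φ) : DominantMap)
      map_one' := by
        refine Quotient.sound (DominantTriple.equiv_of_dehom fun i => ?_)
        refine (congrFun (PolyMap.dehom_homog 1) i).trans ?_
        fin_cases i <;> simp [DominantTriple.id, dehom, PolyMap.one_f]
      map_mul' := fun φ ψ => by
        refine Quotient.sound (DominantTriple.equiv_of_dehom fun i => ?_)
        refine (congrFun (PolyMap.dehom_homog (φ * ψ).1) i).trans
          (Eq.trans ?_ (PolyMap.dehom_bind₁_homog ψ.1 (φ.1.homog i)).symm)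
        rw [show dehom (φ.1.homog i) = _ from congrFun φ.1.dehom_homog i]
        fin_cases i <;> simp [PolyMap.mul_f] }

/-- `φ` is affine: `φ(z) = A z + b` with `A` in `GL(2, ℂ)`. -/
def IsAffineAut (φ : AutC2) : Prop :=
  ∃ (A : GL (Fin 2) ℂ) (b : Fin 2 → ℂ), ∀ i, φ.1.f i = ∑ j, C (A.1 i j) * X j + C (b i)

/-- `φ = (φ₀, φ₁)` is elementary: `φᵢ` depends only on the variables `zⱼ` with `j ≥ i`, that is,
`φ₁` depends only on `z₁`. -/
def IsElementaryAut (φ : AutC2) : Prop :=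
  ∀ i, φ.1.f i ∈ supported ℂ {j | i ≤ j}

/-- `φ` is a generalized Hénon map: `φ = (z₁, P(z₁) - δ z₀)` with `δ ≠ 0` and `deg P ≥ 2`. -/
def IsHenonMap (φ : AutC2) : Prop :=
  ∃ (P : Polynomial ℂ) (δ : ℂ), 2 ≤ P.natDegree ∧ δ ≠ 0 ∧
    φ.1.f 0 = X 1 ∧ φ.1.f 1 = Polynomial.aeval (X 1) P - C δ * X 0

/-! ### The de Jonquières subgroup -/

/-- The de Jonquières group `J₂ = PGL(2, ℂ(z₁)) ⋊ PGL(2, ℂ)` inside `Bir(ℙ²)`: the maps that are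
given in the chart `z₂ = 1` by
`(z₀, z₁) ⇢ ((a(z₁) z₀ + b(z₁)) / (c(z₁) z₀ + d(z₁)), (α z₁ + β) / (γ z₁ + δ))`
with `a d - b c ≠ 0` and `α δ - β γ ≠ 0`. Clearing denominators, `a, b, c, d` are taken to be
polynomials; the fractions are compared with `F₀ / F₂` and `F₁ / F₂` by cross-multiplication. -/
def J2 : Set BirP2 :=
  {Φ | ∃ S : DominantTriple, (Quotient.mk _ S : DominantMap) = Φ.1 ∧
    ∃ (a b c d : Polynomial ℂ) (α β γ δ : ℂ), a * d - b * c ≠ 0 ∧ α * δ - β * γ ≠ 0 ∧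
      dehom (S.F 0) * (Polynomial.aeval (X 1) c * X 0 + Polynomial.aeval (X 1) d) =
        dehom (S.F 2) * (Polynomial.aeval (X 1) a * X 0 + Polynomial.aeval (X 1) b) ∧
      dehom (S.F 1) * (C γ * X 1 + C δ) = dehom (S.F 2) * (C α * X 1 + C β)}

/-! ### Length with respect to involutions -/

/-- `𝔫(g, H)`: the smallest length of a product of involutions (elements of order two) of `H`
that is equal to `g`; it is `⊤` if there is no such product. -/
noncomputable def invLength {G : Type*} [Group G] (g : G) (H : Set G) : ℕ∞ :=
  sInf {n | ∃ l : List G, (∀ s ∈ l, s ∈ H ∧ orderOf s = 2) ∧ l.prod = g ∧ (l.length : ℕ∞) = n}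

/-! ### Locally nilpotent derivations -/

section LocallyNilpotent

variable {R A : Type*} [CommRing R] [CommRing A] [Algebra R A]

/-! The core is a reduction of the degree, of Jung–van der Kulk type: an automorphism of degree at
least 2 is `a * e * ψ` with `a` affine, `e` elementary and the degree of `ψ` a proper divisor
(`exists_affine_mul_elementary_mul`). It follows once the component degrees n₀ ≥ n₁ of φ, with n₀ ≥
2, are shown to satisfy n₁ ∣ n₀, the leading form of φ₀ being a constant times a power of that of φ₁
(`PolyMap.exists_totalDegree_sub_lt`): subtracting that power from φ₀ is a shear.

For this, transport ∂ⱼ by φ. The result is a nonzero locally nilpotent derivation of the target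
plane that kills the component i ≠ j of φ⁻¹. Give z₀, z₁ the weights n₀, n₁. The leading part D of
the derivation is still locally nilpotent and kills the top part r of this component. Substituting φ
into the component gives back a coordinate, of degree 1; so if r has weight at least 2, r vanishes
at the leading forms of φ. By homogeneity r then vanishes on monomial curves s ↦ (u₀s^n₀, u₁s^n₁),
hence is divisible by their binomial equations. The kernel of D is factorially closed, so D kills
these binomials; local nilpotency forces the exponent of z₀ to be 1 and the curves to coincide
(`MvPolynomial.dvd_of_isLocallyNilpotent`).

It remains to count involutions. An affine map costs 8: triangularize it, then split off a
translation, a unipotent matrix and a diagonal matrix, the last one rescaled to determinant 1. An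
elementary map costs 6: a translation of z₁, a shear and a diagonal map, each a product of two
involutions of `J2`; the stated bound 10 is what the totals use. With k reductions, 2 ^ k ≤ d, the
total is 8 + 18k, and 8k ≤ 2 ^ k + 16 turns this into 44 + 9d/4. -/

theorem Derivation.iterate_map_mul (D : Derivation R A A) (n : ℕ) (a b : A) :
    D^[n] (a * b) = ∑ ij ∈ Finset.HasAntidiagonal.antidiagonal n, (n.choose ij.1 : A) * (D^[ij.1] a * D^[ij.2] b) := by
  induction n with
  | zero => simp
  | succ n ih =>
    rw [Finset.sum_antidiagonal_choose_succ_mul (fun i j => D^[i] a * D^[j] b) n,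
      Function.iterate_succ_apply', ih, map_sum, ← Finset.sum_add_distrib]
    refine Finset.sum_congr rfl fun ij hij => ?_
    have h : n.choose ij.2 = n.choose ij.1 := by
      have := Finset.HasAntidiagonal.mem_antidiagonal.mp hij
      rw [← Nat.choose_symm_of_eq_add this.symm]
    simp only [Derivation.leibniz, Derivation.map_natCast, smul_eq_mul,
      Function.iterate_succ_apply', h]
    ring

/-- `a` has degree `n` with respect to the derivation `D`. -/
def Derivation.HasDegree (D : Derivation R A A) (a : A) (n : ℕ) : Prop :=
  D^[n] a ≠ 0 ∧ D^[n + 1] a = 0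

theorem Derivation.iterate_eq_zero_of_le (D : Derivation R A A) {a : A} {m n : ℕ} (h : m ≤ n)
    (hm : D^[m] a = 0) : D^[n] a = 0 := by
  obtain ⟨k, rfl⟩ := Nat.exists_eq_add_of_le' h
  rw [Function.iterate_add_apply, hm, iterate_map_zero]

namespace Derivation.HasDegree

variable {D : Derivation R A A} {a b : A} {m n : ℕ}

theorem ne_zero (h : D.HasDegree a n) : a ≠ 0 := fun h0 => h.1 (by rw [h0, iterate_map_zero])

theorem unique (h : D.HasDegree a m) (h' : D.HasDegree a n) : m = n := by
  rcases lt_trichotomy m n with hl | hl | hl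
  · exact absurd (D.iterate_eq_zero_of_le hl h.2) h'.1
  · exact hl
  · exact absurd (D.iterate_eq_zero_of_le hl h'.2) h.1

/-- In the Leibniz formula for the power m + n only the term D^m a · D^n b survives; its binomial
coefficient is nonzero in characteristic zero. In the power m + n + 1 every term vanishes. -/
theorem mul [IsDomain A] [CharZero A] (ha : D.HasDegree a m) (hb : D.HasDegree b n) :
    D.HasDegree (a * b) (m + n) := by
  constructor
  · rw [D.iterate_map_mul, Finset.sum_eq_single (m, n)]
    · exact mul_ne_zero (Nat.cast_ne_zero.mpr (Nat.choose_pos (Nat.le_add_right m n)).ne')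
        (mul_ne_zero ha.1 hb.1)
    · rintro ⟨i, j⟩ hij hne
      have hij := Finset.HasAntidiagonal.mem_antidiagonal.mp hij
      rcases lt_or_ge m i with hi | hi
      · simp [D.iterate_eq_zero_of_le hi ha.2]
      · have hj : n < j := by
          rcases hi.lt_or_eq with hi | rfl
          · simp only at hij; omega
          · exact absurd (by simp only at hij; simp; omega) hne
        simp [D.iterate_eq_zero_of_le hj hb.2]
    · intro h
      exact (h (by simp)).elim
  · rw [D.iterate_map_mul]
    refine Finset.sum_eq_zero fun ij hij => ?_
    have hij := Finset.HasAntidiagonal.mem_antidiagonal.mp hij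
    rcases lt_or_ge m ij.1 with hi | hi
    · simp [D.iterate_eq_zero_of_le hi ha.2]
    · simp [D.iterate_eq_zero_of_le (show n + 1 ≤ ij.2 by omega) hb.2]

theorem of_apply (h : D.HasDegree (D a) n) : D.HasDegree a (n + 1) := h

end Derivation.HasDegree

/-- Every element is killed by a power of the derivation `D`. -/
def Derivation.IsLocallyNilpotent (D : Derivation R A A) : Prop := ∀ a, ∃ n, D^[n] a = 0

namespace Derivation.IsLocallyNilpotent

variable {D : Derivation R A A}

theorem exists_hasDegree (hD : D.IsLocallyNilpotent) {a : A} (ha : a ≠ 0) :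
    ∃ n, D.HasDegree a n := by
  classical
  have h0 : Nat.find (hD a) ≠ 0 := fun h => ha (by simpa [h] using Nat.find_spec (hD a))
  obtain ⟨n, hn⟩ := Nat.exists_eq_succ_of_ne_zero h0
  refine ⟨n, Nat.find_min (hD a) (by omega), ?_⟩
  have := Nat.find_spec (hD a)
  rwa [hn] at this

variable [IsDomain A] [CharZero A]

/-- The kernel is factorially closed. -/
theorem apply_eq_zero_of_dvd (hD : D.IsLocallyNilpotent) {a b : A} (hab : a ∣ b) (hb : b ≠ 0)
    (h : D b = 0) : D a = 0 := by
  obtain ⟨c, rfl⟩ := hab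
  obtain ⟨m, hm⟩ := hD.exists_hasDegree (left_ne_zero_of_mul hb)
  obtain ⟨n, hn⟩ := hD.exists_hasDegree (right_ne_zero_of_mul hb)
  have h0 : m + n = 0 := (hm.mul hn).unique ⟨hb, h⟩
  obtain rfl : m = 0 := by omega
  exact hm.2

/-- Degrees with respect to D add up on products and drop by one under D. So u ∣ D v makes the
degree of u smaller than that of v, and v ∣ D u would give the reverse. -/
theorem not_dvd_of_dvd (hD : D.IsLocallyNilpotent) {u v : A} (hu : D u ≠ 0) (hv : D v ≠ 0)
    (huv : u ∣ D v) : ¬ v ∣ D u := by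
  rintro ⟨r, hr⟩
  obtain ⟨s, hs⟩ := huv
  rw [hr] at hu
  rw [hs] at hv
  obtain ⟨i, hi⟩ := hD.exists_hasDegree (left_ne_zero_of_mul hv)
  obtain ⟨j, hj⟩ := hD.exists_hasDegree (left_ne_zero_of_mul hu)
  obtain ⟨k, hk⟩ := hD.exists_hasDegree (right_ne_zero_of_mul hu)
  obtain ⟨l, hl⟩ := hD.exists_hasDegree (right_ne_zero_of_mul hv)
  have h1 := hi.unique (HasDegree.of_apply (hr ▸ hj.mul hk))
  have h2 := hj.unique (HasDegree.of_apply (hs ▸ hi.mul hl))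
  omega

end Derivation.IsLocallyNilpotent

end LocallyNilpotent

/-! ### Weight filtrations and leading parts of derivations -/

section WeightFiltration

namespace MvPolynomial

variable {σ R : Type*} [CommRing R]

/-- All monomials of `p` have weight at most `k`. -/
def WeightLE (w : σ → ℤ) (k : ℤ) (p : MvPolynomial σ R) : Prop :=
  ∀ e, coeff e p ≠ 0 → Finsupp.weight w e ≤ k

variable {w : σ → ℤ} {k l : ℤ} {p q : MvPolynomial σ R}

theorem WeightLE.add (hp : WeightLE w k p) (hq : WeightLE w k q) : WeightLE w k (p + q) := by
  intro e he
  by_cases h : coeff e p = 0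
  · exact hq e fun h' => he (by rw [coeff_add, h, h', add_zero])
  · exact hp e h

theorem WeightLE.neg (hp : WeightLE w k p) : WeightLE w k (-p) :=
  fun e he => hp e (by simpa using he)

theorem WeightLE.mono (hp : WeightLE w k p) (h : k ≤ l) : WeightLE w l p :=
  fun e he => (hp e he).trans h

theorem weightLE_zero : WeightLE w k (0 : MvPolynomial σ R) := fun e he => absurd (coeff_zero e) he

theorem WeightLE.sum {ι : Type*} {s : Finset ι} {f : ι → MvPolynomial σ R}
    (h : ∀ i ∈ s, WeightLE w k (f i)) : WeightLE w k (∑ i ∈ s, f i) := by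
  classical
  induction s using Finset.induction_on with
  | empty => exact weightLE_zero
  | insert a s ha ih =>
    rw [Finset.sum_insert ha]
    exact (h a (by simp)).add (ih fun i hi => h i (by simp [hi]))

theorem WeightLE.mul (hp : WeightLE w k p) (hq : WeightLE w l q) : WeightLE w (k + l) (p * q) := by
  classical
  intro e he
  rw [coeff_mul] at he
  obtain ⟨ij, hij, h⟩ := Finset.exists_ne_zero_of_sum_ne_zero he
  rw [← Finset.HasAntidiagonal.mem_antidiagonal.mp hij, map_add]
  exact add_le_add (hp _ (left_ne_zero_of_mul h)) (hq _ (right_ne_zero_of_mul h))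

theorem WeightLE.pderiv (hp : WeightLE w k p) (i : σ) :
    WeightLE w (k - w i) (MvPolynomial.pderiv i p) := by
  intro e he
  rw [coeff_pderiv] at he
  have := hp _ (left_ne_zero_of_mul he)
  rw [map_add, Finsupp.weight_single, one_smul] at this
  linarith

theorem IsWeightedHomogeneous.weightLE (hp : IsWeightedHomogeneous w p k) : WeightLE w k p :=
  fun _ he => (hp he).le

theorem WeightLE.eq_zero_of_isWeightedHomogeneous (hp : WeightLE w l p)
    (h : IsWeightedHomogeneous w p k) (hl : l < k) : p = 0 := by
  ext e
  rw [coeff_zero]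
  by_contra he
  have := hp e he
  have := h he
  omega

theorem WeightLE.sub_component (hp : WeightLE w k p) :
    WeightLE w (k - 1) (p - weightedHomogeneousComponent w k p) := by
  classical
  intro e he
  rw [coeff_sub, coeff_weightedHomogeneousComponent] at he
  split_ifs at he with h
  · simp at he
  · rw [sub_zero] at he
    have := hp e he
    omega

theorem WeightLE.eq_zero (hw : ∀ i, 0 ≤ w i) (hp : WeightLE w k p) (hk : k < 0) : p = 0 := by
  ext e
  rw [coeff_zero]
  by_contra he
  have h1 := hp e he
  have h2 : 0 ≤ Finsupp.weight w e := by
    rw [Finsupp.weight_apply]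
    exact Finset.sum_nonneg fun i _ => nsmul_nonneg (hw i) _
  omega

theorem exists_weightLE (w : σ → ℤ) (p : MvPolynomial σ R) : ∃ k : ℕ, WeightLE w k p := by
  refine ⟨∑ e ∈ p.support, (Finsupp.weight w e).natAbs, fun e he => ?_⟩
  have := Finset.single_le_sum (f := fun e => (Finsupp.weight w e).natAbs)
    (fun _ _ => Nat.zero_le _) (mem_support_iff.mpr he)
  omega

theorem exists_weightLE_component_ne_zero (hw : ∀ i, 0 ≤ w i) (hp : p ≠ 0) :
    ∃ N : ℕ, WeightLE w N p ∧ weightedHomogeneousComponent w (N : ℤ) p ≠ 0 := by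
  classical
  refine ⟨Nat.find (exists_weightLE w p), Nat.find_spec (exists_weightLE w p), fun h => ?_⟩
  have h1 := (Nat.find_spec (exists_weightLE w p)).sub_component
  rw [h, sub_zero] at h1
  cases hN : Nat.find (exists_weightLE w p) with
  | zero =>
    rw [hN] at h1
    exact hp (h1.eq_zero hw (by simp))
  | succ n =>
    rw [hN] at h1
    exact Nat.find_min (exists_weightLE w p) (m := n) (by omega) (h1.mono (by push_cast; omega))

/-- Since ∂ᵢ lowers the weight by w i, the field with components a shifts weights by at most k
exactly under the bound w i + k on each a i. The least such k, possibly negative, is attained by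
some component. -/
theorem exists_weightLE_family [Finite σ] (hw : ∀ i, 0 ≤ w i) {a : σ → MvPolynomial σ R}
    (ha : a ≠ 0) : ∃ k, (∀ i, WeightLE w (w i + k) (a i)) ∧
      ∃ i, weightedHomogeneousComponent w (w i + k) (a i) ≠ 0 := by
  classical
  cases nonempty_fintype σ
  obtain ⟨i₀, hi₀⟩ := Function.ne_iff.mp ha
  choose n hn using fun i => exists_weightLE w (a i)
  obtain ⟨k, hk, hmin⟩ := Int.exists_least_of_bdd
    (P := fun k => ∀ i, WeightLE w (w i + k) (a i))
    ⟨-w i₀, fun k hk => by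
      by_contra hlt
      exact hi₀ ((hk i₀).eq_zero hw (by omega))⟩
    ⟨∑ i, (n i : ℤ), fun i => (hn i).mono (by
      have := Finset.single_le_sum (f := fun i => (n i : ℤ)) (fun _ _ => Int.natCast_nonneg _)
        (Finset.mem_univ i)
      have := hw i
      omega)⟩
  refine ⟨k, hk, ?_⟩
  by_contra! h
  have := hmin (k - 1) fun i => by
    have h1 := (hk i).sub_component
    rw [h i, sub_zero] at h1
    exact h1.mono (by omega)
  omega

variable [Fintype σ]

/-- The derivation with components `a`. -/
noncomputable def vecDerivation (a : σ → MvPolynomial σ R) :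
    Derivation R (MvPolynomial σ R) (MvPolynomial σ R) := ∑ i, a i • pderiv i

theorem vecDerivation_apply (a : σ → MvPolynomial σ R) (p : MvPolynomial σ R) :
    vecDerivation a p = ∑ i, a i * pderiv i p := by
  simp only [vecDerivation, ← Derivation.coeFnAddMonoidHom_apply, map_sum, Finset.sum_apply]
  rfl

theorem vecDerivation_X (a : σ → MvPolynomial σ R) (i : σ) : vecDerivation a (X i) = a i := by
  classical
  simp [vecDerivation_apply, Pi.single_apply]

theorem vecDerivation_sub (a b : σ → MvPolynomial σ R) (p : MvPolynomial σ R) :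
    vecDerivation (a - b) p = vecDerivation a p - vecDerivation b p := by
  simp only [vecDerivation_apply, ← Finset.sum_sub_distrib, Pi.sub_apply, sub_mul]

theorem WeightLE.vecDerivation {a : σ → MvPolynomial σ R} (ha : ∀ i, WeightLE w (w i + l) (a i))
    (hp : WeightLE w k p) : WeightLE w (k + l) (vecDerivation a p) := by
  rw [vecDerivation_apply]
  refine WeightLE.sum fun i _ => ?_
  convert (ha i).mul (hp.pderiv i) using 1
  ring

theorem IsWeightedHomogeneous.vecDerivation {a : σ → MvPolynomial σ R}
    (ha : ∀ i, IsWeightedHomogeneous w (a i) (w i + l)) (hp : IsWeightedHomogeneous w p k) :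
    IsWeightedHomogeneous w (vecDerivation a p) (k + l) := by
  rw [vecDerivation_apply]
  refine IsWeightedHomogeneous.sum _ _ _ fun i _ => ?_
  convert (ha i).mul (IsWeightedHomogeneous.pderiv (n' := k - w i) (i := i) hp (by ring)) using 1
  ring

/-- The leading part of a locally nilpotent derivation is locally nilpotent, and it kills the
leading parts of the elements that the derivation kills. -/
theorem exists_leading_vecDerivation (hw : ∀ i, 0 ≤ w i) {a : σ → MvPolynomial σ R} (ha : a ≠ 0)
    (hD : (MvPolynomial.vecDerivation a).IsLocallyNilpotent) :
    ∃ b : σ → MvPolynomial σ R, b ≠ 0 ∧ (MvPolynomial.vecDerivation b).IsLocallyNilpotent ∧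
      ∀ (k : ℤ) (p : MvPolynomial σ R), WeightLE w k p → MvPolynomial.vecDerivation a p = 0 →
        MvPolynomial.vecDerivation b (weightedHomogeneousComponent w k p) = 0 := by
  obtain ⟨l, hl, i₀, hi₀⟩ := exists_weightLE_family hw ha
  set b : σ → MvPolynomial σ R := fun i => weightedHomogeneousComponent w (w i + l) (a i) with hb
  have hbh : ∀ i, IsWeightedHomogeneous w (b i) (w i + l) := fun i =>
    weightedHomogeneousComponent_isWeightedHomogeneous _ _
  have hab : ∀ i, WeightLE w (w i + (l - 1)) ((a - b) i) := fun i =>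
    (hl i).sub_component.mono (by omega)
  refine ⟨b, fun h => hi₀ (congrFun h i₀), fun p => ?_, fun k p hp h => ?_⟩
  -- On a homogeneous p the n-th iterates of the derivation and of its leading part agree up to
  -- lower weight. When the former vanishes, the latter is both homogeneous and of lower weight,
  -- hence zero.
  · have key : ∀ (k : ℤ) (p : MvPolynomial σ R) (n : ℕ), IsWeightedHomogeneous w p k →
        IsWeightedHomogeneous w ((MvPolynomial.vecDerivation b)^[n] p) (k + n * l) ∧
        WeightLE w (k + n * l - 1) ((MvPolynomial.vecDerivation a)^[n] p
          - (MvPolynomial.vecDerivation b)^[n] p) := by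
      intro k p n hp
      induction n with
      | zero => exact ⟨by simpa using hp, by simpa using weightLE_zero⟩
      | succ n ih =>
        simp only [Function.iterate_succ_apply']
        constructor
        · convert IsWeightedHomogeneous.vecDerivation hbh ih.1 using 1
          push_cast; ring
        · have h1 := WeightLE.vecDerivation hl ih.2
          have h2 := WeightLE.vecDerivation hab ih.1.weightLE
          rw [vecDerivation_sub] at h2
          rw [map_sub] at h1
          convert (h1.mono (l := k + ↑(n + 1) * l - 1) (by push_cast; linarith)).add
            (h2.mono (by push_cast; linarith)) using 1
          ring
    induction p using MvPolynomial.induction_on' with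
    | monomial e r =>
      obtain ⟨n, hn⟩ := hD (monomial e r)
      obtain ⟨h1, h2⟩ := key _ _ n (isWeightedHomogeneous_monomial w e r rfl)
      rw [hn, zero_sub] at h2
      exact ⟨n, (neg_neg ((MvPolynomial.vecDerivation b)^[n] _) ▸ h2.neg
        ).eq_zero_of_isWeightedHomogeneous h1 (by omega)⟩
    | add p q hp hq =>
      obtain ⟨m, hm⟩ := hp
      obtain ⟨n, hn⟩ := hq
      refine ⟨max m n, ?_⟩
      rw [iterate_map_add, Derivation.iterate_eq_zero_of_le _ (le_max_left m n) hm,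
        Derivation.iterate_eq_zero_of_le _ (le_max_right m n) hn, add_zero]
  · have hc := weightedHomogeneousComponent_isWeightedHomogeneous (w := w) k p
    have h1 := WeightLE.vecDerivation hl hp.sub_component
    have h2 := WeightLE.vecDerivation hab hc.weightLE
    rw [map_sub, h, zero_sub] at h1
    rw [vecDerivation_sub] at h2
    refine WeightLE.eq_zero_of_isWeightedHomogeneous (l := k + l - 1) ?_
      (IsWeightedHomogeneous.vecDerivation hbh hc) (by omega)
    have h3 := (h1.mono (l := k + l - 1) (by omega)).add (h2.mono (by omega))
    convert h3.neg using 1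
    ring

end MvPolynomial

end WeightFiltration

/-! ### Monomial curves and their binomial equations -/

section CurveDivisibility

namespace MvPolynomial

theorem weight_natCast {σ : Type*} (n : σ → ℕ) (e : σ →₀ ℕ) :
    Finsupp.weight (fun i => (n i : ℤ)) e = (e.sum fun i k => n i * k : ℕ) := by
  rw [Finsupp.weight_apply, Finsupp.sum, Finsupp.sum, Nat.cast_sum]
  exact Finset.sum_congr rfl fun i _ => by rw [nsmul_eq_mul, Nat.cast_mul, mul_comm]

variable {σ K : Type*} [Field K]

theorem natDegree_aeval_monomial_le {n : σ → ℕ} {P : σ → Polynomial K}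
    (hP : ∀ i, (P i).natDegree ≤ n i) (e : σ →₀ ℕ) (a : K) :
    (aeval P (monomial e a)).natDegree ≤ e.sum fun i k => n i * k := by
  rw [aeval_monomial, Polynomial.algebraMap_eq]
  refine (Polynomial.natDegree_C_mul_le _ _).trans ((Polynomial.natDegree_prod_le _ _).trans ?_)
  exact Finset.sum_le_sum fun i _ => Polynomial.natDegree_pow_le.trans
    (by rw [mul_comm]; exact Nat.mul_le_mul_right _ (hP i))

theorem coeff_aeval_monomial {n : σ → ℕ} {P : σ → Polynomial K}
    (hP : ∀ i, (P i).natDegree ≤ n i) (e : σ →₀ ℕ) (a : K) :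
    (aeval P (monomial e a)).coeff (e.sum fun i k => n i * k) =
      eval (fun i => (P i).coeff (n i)) (monomial e a) := by
  classical
  rw [aeval_monomial, Polynomial.algebraMap_eq, Polynomial.coeff_C_mul, eval_monomial]
  congr 1
  have : ∀ s : Finset σ, (∏ i ∈ s, P i ^ e i).natDegree ≤ ∑ i ∈ s, n i * e i ∧
      (∏ i ∈ s, P i ^ e i).coeff (∑ i ∈ s, n i * e i) = ∏ i ∈ s, (P i).coeff (n i) ^ e i := by
    intro s
    have h0 : ∀ i, (P i ^ e i).natDegree ≤ n i * e i := fun i =>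
      Polynomial.natDegree_pow_le.trans (by rw [mul_comm]; exact Nat.mul_le_mul_right _ (hP i))
    induction s using Finset.induction_on with
    | empty => simp
    | insert i s hi ih =>
      rw [Finset.prod_insert hi, Finset.sum_insert hi, Finset.prod_insert hi]
      refine ⟨Polynomial.natDegree_mul_le_of_le (h0 i) ih.1, ?_⟩
      rw [Polynomial.coeff_mul_add_eq_of_natDegree_le (h0 i) ih.1, ih.2]
      congr 1
      rw [mul_comm, Polynomial.coeff_pow_of_natDegree_le (hP i)]
  exact (this e.support).2

/-- The coefficient at the weight bound N sees only the top-weight part of p and the coefficients of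
the P i at their degree bounds. -/
theorem coeff_aeval_of_weightLE {n : σ → ℕ} {P : σ → Polynomial K}
    (hP : ∀ i, (P i).natDegree ≤ n i) {p : MvPolynomial σ K} {N : ℕ}
    (hp : WeightLE (fun i => (n i : ℤ)) N p) :
    (aeval P p).coeff N = eval (fun i => (P i).coeff (n i))
      (weightedHomogeneousComponent (fun i => (n i : ℤ)) (N : ℤ) p) := by
  classical
  rw [weightedHomogeneousComponent_apply, map_sum, Finset.sum_filter]
  conv_lhs => rw [p.as_sum]
  rw [map_sum, Polynomial.finsetSum_coeff]
  refine Finset.sum_congr rfl fun e he => ?_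
  have h1 := hp e (mem_support_iff.mp he)
  rw [weight_natCast] at h1 ⊢
  split_ifs with h
  · rw [← coeff_aeval_monomial hP, ← Nat.cast_injective h]
  · refine Polynomial.coeff_eq_zero_of_natDegree_lt
      ((natDegree_aeval_monomial_le hP _ _).trans_lt ?_)
    omega

theorem IsWeightedHomogeneous.aeval_curve {n : σ → ℕ} {p : MvPolynomial σ K} {N : ℕ}
    (hp : IsWeightedHomogeneous (fun i => (n i : ℤ)) p N) (u : σ → K) :
    aeval (fun i => Polynomial.C (u i) * Polynomial.X ^ n i) p =
      Polynomial.C (eval u p) * Polynomial.X ^ N := by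
  conv_lhs => rw [p.as_sum]
  conv_rhs => rw [p.as_sum]
  rw [map_sum, map_sum, map_sum, Finset.sum_mul]
  refine Finset.sum_congr rfl fun e he => ?_
  have h := hp (mem_support_iff.mp he)
  rw [weight_natCast] at h
  rw [aeval_monomial, Polynomial.algebraMap_eq, eval_monomial, map_mul, ← Nat.cast_injective h,
    mul_assoc]
  congr 1
  simp only [Finsupp.prod, Finsupp.sum, map_prod, map_pow, mul_pow, Finset.prod_mul_distrib,
    ← pow_mul, Finset.prod_pow_eq_pow_sum]

/-- Division with remainder: each factor X₀^m is replaced by c X₁^d. -/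
theorem exists_reduction_mod_binomial (c : K) {m : ℕ} (hm : 0 < m) (d : ℕ)
    (p : MvPolynomial (Fin 2) K) :
    ∃ r, (X 0 ^ m - C c * X 1 ^ d) ∣ p - r ∧ ∀ e, coeff e r ≠ 0 → e 0 < m := by
  classical
  induction p using MvPolynomial.induction_on' with
  | monomial e a =>
    set s : Fin 2 →₀ ℕ := Finsupp.single 0 (e 0 % m) + Finsupp.single 1 (d * (e 0 / m) + e 1)
    refine ⟨monomial s (a * c ^ (e 0 / m)), ?_, fun e' he' => ?_⟩
    · have h1 : monomial e a = C a * X 0 ^ (e 0 % m) * X 1 ^ e 1 * (X 0 ^ m) ^ (e 0 / m) := by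
        rw [monomial_eq, Finsupp.prod_fintype _ _ (fun i => pow_zero _), Fin.prod_univ_two]
        conv_lhs => rw [← Nat.mod_add_div (e 0) m]
        rw [pow_add, pow_mul]
        ring
      have h2 : monomial s (a * c ^ (e 0 / m)) =
          C a * X 0 ^ (e 0 % m) * X 1 ^ e 1 * (C c * X 1 ^ d) ^ (e 0 / m) := by
        rw [monomial_eq, Finsupp.prod_fintype _ _ (fun i => pow_zero _), Fin.prod_univ_two]
        simp only [s, Finsupp.add_apply, Finsupp.single_apply]
        simp
        ring
      rw [h1, h2, ← mul_sub]
      exact (sub_dvd_pow_sub_pow _ _ _).mul_left _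
    · rw [coeff_monomial] at he'
      split_ifs at he' with h
      · rw [← h]
        simpa [s] using Nat.mod_lt _ hm
      · exact absurd rfl he'
  | add p q hp hq =>
    obtain ⟨r, hr, hr'⟩ := hp
    obtain ⟨t, ht, ht'⟩ := hq
    refine ⟨r + t, ?_, fun e he => ?_⟩
    · convert dvd_add hr ht using 1
      ring
    · by_cases h : coeff e r = 0
      · exact ht' e fun h' => he (by rw [coeff_add, h, h', add_zero])
      · exact hr' e h

/-- Reduce p modulo the binomial to a remainder of X₀-degree below m. As d and m are coprime,
distinct monomials of the remainder restrict to distinct powers on the curve, so vanishing on the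
curve forces the remainder to be zero. -/
theorem binomial_dvd_of_aeval_curve_eq_zero {u : Fin 2 → K} (hu : ∀ i, u i ≠ 0) {g d m : ℕ}
    (hg : 0 < g) (hm : 0 < m) (hdm : Nat.Coprime d m) {p : MvPolynomial (Fin 2) K}
    (hp : aeval (fun i => Polynomial.C (u i) * Polynomial.X ^ (![g * d, g * m] i)) p = 0) :
    (X 0 ^ m - C (u 0 ^ m / u 1 ^ d) * X 1 ^ d) ∣ p := by
  classical
  obtain ⟨r, ⟨t, ht⟩, hr⟩ := exists_reduction_mod_binomial (u 0 ^ m / u 1 ^ d) hm d p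
  suffices r = 0 from ⟨t, by rw [← ht, this, sub_zero]⟩
  set κ := aeval (R := K) (fun i => Polynomial.C (u i) * Polynomial.X ^ (![g * d, g * m] i)) with hκ
  have hs : κ (X 0 ^ m - C (u 0 ^ m / u 1 ^ d) * X 1 ^ d) = 0 := by
    have h1 : u 0 ^ m / u 1 ^ d * u 1 ^ d = u 0 ^ m := div_mul_cancel₀ _ (pow_ne_zero _ (hu 1))
    simp only [hκ, map_sub, map_mul, map_pow, aeval_X, algHom_C, Polynomial.algebraMap_eq]
    simp only [Matrix.cons_val_zero, Matrix.cons_val_one, mul_pow, ← mul_assoc,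
      ← Polynomial.C_pow, ← Polynomial.C_mul, h1, ← pow_mul]
    rw [show g * d * m = g * m * d by ring, sub_self]
  have hκr : κ r = 0 := by
    have := congrArg κ ht
    rwa [map_sub, map_mul, hs, zero_mul, hp, zero_sub, neg_eq_zero] at this
  ext e
  rw [coeff_zero]
  by_contra he
  have h1 := congrArg (fun P => Polynomial.coeff P (g * d * e 0 + g * m * e 1)) hκr
  simp only [Polynomial.coeff_zero] at h1
  rw [r.as_sum, map_sum, Polynomial.finsetSum_coeff] at h1
  have h2 : ∀ e' : Fin 2 →₀ ℕ, κ (monomial e' (coeff e' r)) =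
      Polynomial.C (coeff e' r * (u 0 ^ e' 0 * u 1 ^ e' 1)) *
        Polynomial.X ^ (g * d * e' 0 + g * m * e' 1) := by
    intro e'
    rw [hκ, aeval_monomial, Finsupp.prod_fintype _ _ (fun i => pow_zero _), Fin.prod_univ_two,
      Polynomial.algebraMap_eq]
    simp only [Matrix.cons_val_zero, Matrix.cons_val_one, map_mul, map_pow]
    ring
  rw [Finset.sum_eq_single e] at h1
  · rw [h2, Polynomial.coeff_C_mul_X_pow, if_pos rfl] at h1
    exact mul_ne_zero he (mul_ne_zero (pow_ne_zero _ (hu 0)) (pow_ne_zero _ (hu 1))) h1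
  · intro e' he' hne
    rw [h2, Polynomial.coeff_C_mul_X_pow, if_neg]
    intro h
    have a1 := hr e he
    have a2 := hr e' (mem_support_iff.mp he')
    have h3 : d * e 0 + m * e 1 = d * e' 0 + m * e' 1 := by
      apply Nat.eq_of_mul_eq_mul_left hg
      linarith
    have h4 : e 0 ≡ e' 0 [MOD m] := by
      refine Nat.ModEq.cancel_left_of_coprime (c := d) (by rwa [Nat.coprime_comm] at hdm) ?_
      have := congrArg (· % m) h3
      simpa [Nat.ModEq, Nat.add_mul_mod_self_left] using this
    have h5 : e 0 = e' 0 := h4.eq_of_lt_of_lt a1 a2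
    have h6 : e 1 = e' 1 := by
      rw [h5] at h3
      exact Nat.eq_of_mul_eq_mul_left hm (by omega)
    exact hne (Finsupp.ext fun i => by fin_cases i <;> simp [h5, h6])
  · intro h
    exact absurd (notMem_support_iff.mp h) he

variable [CharZero K]

/-- If a nonzero locally nilpotent derivation of the plane kills a polynomial that vanishes on the
curves `t ↦ (u₀ t ^ d, u₁ t ^ m)` for all `u` in a set, then `m` divides `d`, and these curves
coincide. -/
theorem dvd_of_isLocallyNilpotent
    {D : Derivation K (MvPolynomial (Fin 2) K) (MvPolynomial (Fin 2) K)}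
    (hD : D.IsLocallyNilpotent) (hD0 : D ≠ 0) {p : MvPolynomial (Fin 2) K} (hp0 : p ≠ 0)
    (hp : D p = 0) {d m : ℕ} (hm : 0 < m) (hmd : m ≤ d) {U : Set (Fin 2 → K)} (hU : U.Nonempty)
    (hU0 : ∀ u ∈ U, ∀ i, u i ≠ 0)
    (hUp : ∀ u ∈ U, aeval (fun i => Polynomial.C (u i) * Polynomial.X ^ (![d, m] i)) p = 0) :
    m ∣ d ∧ ∃ c, ∀ u ∈ U, u 0 = c * u 1 ^ (d / m) := by
  obtain ⟨g, d', m', hg, hcop, rfl, rfl⟩ : ∃ g d' m', 0 < g ∧ Nat.Coprime d' m' ∧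
      d = g * d' ∧ m = g * m' :=
    ⟨d.gcd m, d / d.gcd m, m / d.gcd m, Nat.gcd_pos_of_pos_right _ hm,
      Nat.coprime_div_gcd_div_gcd (Nat.gcd_pos_of_pos_right _ hm),
      (Nat.mul_div_cancel' (Nat.gcd_dvd_left _ _)).symm,
      (Nat.mul_div_cancel' (Nat.gcd_dvd_right _ _)).symm⟩
  have hm' : 0 < m' := Nat.pos_of_mul_pos_left hm
  have hmd' : m' ≤ d' := Nat.le_of_mul_le_mul_left hmd hg
  -- The binomial equation of each curve divides p, and the kernel of D is factorially closed.
  have key : ∀ u ∈ U, D (X 0 ^ m' - C (u 0 ^ m' / u 1 ^ d') * X 1 ^ d') = 0 := fun u hu =>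
    hD.apply_eq_zero_of_dvd (binomial_dvd_of_aeval_curve_eq_zero (hU0 u hu) hg hm' hcop
      (hUp u hu)) hp0 hp
  have hD1 : D (X 0) ≠ 0 ∨ D (X 1) ≠ 0 := by
    by_contra! h
    exact hD0 (MvPolynomial.derivation_ext fun i => by fin_cases i; exacts [h.1, h.2])
  have key' : ∀ u ∈ U, (m' : MvPolynomial (Fin 2) K) * X 0 ^ (m' - 1) * D (X 0) =
      C (u 0 ^ m' / u 1 ^ d') * (d' : MvPolynomial (Fin 2) K) * X 1 ^ (d' - 1) * D (X 1) := by
    intro u hu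
    have := key u hu
    rw [map_sub, Derivation.leibniz_pow, Derivation.leibniz, derivation_C, smul_zero, add_zero,
      Derivation.leibniz_pow, sub_eq_zero,
      smul_eq_mul, smul_eq_mul, smul_eq_mul, nsmul_eq_mul, nsmul_eq_mul] at this
    rw [mul_assoc, this]
    ring
  have hc0 : ∀ u ∈ U, u 0 ^ m' / u 1 ^ d' ≠ 0 := fun u hu =>
    div_ne_zero (pow_ne_zero _ (hU0 u hu 0)) (pow_ne_zero _ (hU0 u hu 1))
  have hm0 : (m' : MvPolynomial (Fin 2) K) ≠ 0 := Nat.cast_ne_zero.mpr hm'.ne'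
  have hd0 : (d' : MvPolynomial (Fin 2) K) ≠ 0 := Nat.cast_ne_zero.mpr (by omega)
  have hX : ∀ i : Fin 2, (X i : MvPolynomial (Fin 2) K) ≠ 0 := X_ne_zero
  obtain ⟨u₀, hu₀⟩ := hU
  have hC0 : (C (u₀ 0 ^ m' / u₀ 1 ^ d') : MvPolynomial (Fin 2) K) ≠ 0 := by
    simpa using hc0 u₀ hu₀
  have hDX1 : D (X 1) ≠ 0 := by
    intro h
    have h1 := key' u₀ hu₀
    rw [h, mul_zero] at h1
    have h2 : D (X 0) = 0 :=
      (mul_eq_zero.mp h1).resolve_left (mul_ne_zero hm0 (pow_ne_zero _ (hX 0)))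
    exact hD1.elim (fun h' => h' h2) fun h' => h' h
  have hDX0 : D (X 0) ≠ 0 := by
    intro h
    have h1 := key' u₀ hu₀
    rw [h, mul_zero] at h1
    exact (mul_ne_zero (mul_ne_zero (mul_ne_zero hC0 hd0) (pow_ne_zero _ (hX 1))) hDX1) h1.symm
  -- Otherwise both exponents m' - 1 and d' - 1 are positive, and `key'` gives X₀ ∣ D X₁ and X₁ ∣ D
  -- X₀, which local nilpotency excludes.
  have hm1 : m' = 1 := by
    by_contra hne
    have hd2 : d' - 1 ≠ 0 := by omega
    have hm2 : m' - 1 ≠ 0 := by omega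
    have hk := key' u₀ hu₀
    have hunit : ∀ n : ℕ, n ≠ 0 → ¬ (∃ i : Fin 2, X i ∣ (n : MvPolynomial (Fin 2) K)) := by
      rintro n hn ⟨i, hi⟩
      refine (X_prime (R := K) (i := i)).not_isUnit (isUnit_of_dvd_unit hi ?_)
      rw [← map_natCast (C (σ := Fin 2) (R := K))]
      exact (isUnit_iff_ne_zero.mpr (Nat.cast_ne_zero.mpr hn)).map C
    have hunitC : ∀ i : Fin 2, ¬ X i ∣ (C (u₀ 0 ^ m' / u₀ 1 ^ d') : MvPolynomial (Fin 2) K) :=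
      fun i hi => (X_prime (R := K) (i := i)).not_isUnit (isUnit_of_dvd_unit hi
        ((isUnit_iff_ne_zero.mpr (hc0 u₀ hu₀)).map C))
    have h01 : ∀ (i j : Fin 2) (n : ℕ), i ≠ j → ¬ X i ∣ (X j : MvPolynomial (Fin 2) K) ^ n :=
      fun i j n hij h => hij (X_dvd_X.mp (X_prime.dvd_of_dvd_pow h))
    have h1 : (X 0 : MvPolynomial (Fin 2) K) ∣ D (X 1) := by
      have : (X 0 : MvPolynomial (Fin 2) K) ∣
          C (u₀ 0 ^ m' / u₀ 1 ^ d') * (d' : MvPolynomial (Fin 2) K) * X 1 ^ (d' - 1) * D (X 1) :=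
        hk ▸ ((dvd_pow_self _ hm2).mul_left _).mul_right _
      rcases X_prime.dvd_or_dvd this with h | h
      · rcases X_prime.dvd_or_dvd h with h | h
        · rcases X_prime.dvd_or_dvd h with h | h
          · exact (hunitC 0 h).elim
          · exact (hunit d' (by omega) ⟨0, h⟩).elim
        · exact (h01 0 1 _ (by decide) h).elim
      · exact h
    have h2 : (X 1 : MvPolynomial (Fin 2) K) ∣ D (X 0) := by
      have : (X 1 : MvPolynomial (Fin 2) K) ∣ (m' : MvPolynomial (Fin 2) K) * X 0 ^ (m' - 1) *
          D (X 0) := hk ▸ ((dvd_pow_self _ hd2).mul_left _).mul_right _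
      rcases X_prime.dvd_or_dvd this with h | h
      · rcases X_prime.dvd_or_dvd h with h | h
        · exact (hunit m' (by omega) ⟨1, h⟩).elim
        · exact (h01 1 0 _ (by decide) h).elim
      · exact h
    exact hD.not_dvd_of_dvd hDX0 hDX1 h1 h2
  subst hm1
  refine ⟨⟨d', by ring⟩, u₀ 0 / u₀ 1 ^ d', fun u hu => ?_⟩
  -- The left side of `key'` does not depend on u; cancelling D X₁ ≠ 0 shows that neither does the
  -- scalar of the binomial.
  have h1 := (key' u hu).symm.trans (key' u₀ hu₀)
  have h2 := mul_right_cancel₀ hd0 (mul_right_cancel₀ (pow_ne_zero _ (hX 1))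
    (mul_right_cancel₀ hDX1 h1))
  have h3 := C_injective _ _ h2
  simp only [pow_one] at h3
  rw [mul_one, Nat.mul_div_cancel_left _ hg, ← h3, div_mul_cancel₀ _ (pow_ne_zero _ (hU0 u hu 1))]

end MvPolynomial

end CurveDivisibility

/-! ### Degrees of the components of a polynomial automorphism -/

section ComponentDegrees

namespace MvPolynomial

theorem pderiv_bind₁ {σ τ R : Type*} [CommRing R] [Fintype σ] (f : σ → MvPolynomial τ R)
    (p : MvPolynomial σ R) (j : τ) :
    pderiv j (bind₁ f p) = ∑ i, bind₁ f (pderiv i p) * pderiv j (f i) := by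
  classical
  induction p using MvPolynomial.induction_on with
  | C a => simp
  | add p q hp hq => simp [hp, hq, add_mul, Finset.sum_add_distrib]
  | mul_X p i h =>
    simp only [map_mul, bind₁_X_right, Derivation.leibniz, smul_eq_mul, h, map_add, add_mul,
      Finset.sum_add_distrib, pderiv_X, Finset.mul_sum]
    congr 1
    · rw [Finset.sum_eq_single i]
      · simp
      · intro k _ hk
        simp [hk.symm]
      · simp
    · exact Finset.sum_congr rfl fun k _ => by ring

theorem weightLE_one_iff {σ R : Type*} [CommRing R] {p : MvPolynomial σ R} {n : ℕ} :
    WeightLE (fun _ => ((1 : ℕ) : ℤ)) n p ↔ p.totalDegree ≤ n := by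
  have h : ∀ e : σ →₀ ℕ, Finsupp.weight (fun _ => ((1 : ℕ) : ℤ)) e = (e.sum fun _ k => k : ℕ) :=
    fun e => by rw [weight_natCast (fun _ => 1) e]; simp only [one_mul]
  constructor
  · intro hp
    refine Finset.sup_le fun e he => ?_
    have := hp e (mem_support_iff.mp he)
    rw [h] at this
    exact_mod_cast this
  · intro hp e he
    rw [h]
    exact_mod_cast (le_totalDegree (mem_support_iff.mpr he)).trans hp

theorem isLocallyNilpotent_pderiv {σ R : Type*} [CommRing R] (j : σ) :
    (pderiv (R := R) j).IsLocallyNilpotent := by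
  intro p
  obtain ⟨N, hN⟩ := exists_weightLE (fun _ => ((1 : ℕ) : ℤ)) p
  have : ∀ n : ℕ, WeightLE (fun _ => ((1 : ℕ) : ℤ)) (N - n) ((pderiv j)^[n] p) := by
    intro n
    induction n with
    | zero => simpa using hN
    | succ n ih =>
      rw [Function.iterate_succ_apply']
      exact (ih.pderiv j).mono (by push_cast; omega)
  exact ⟨N + 1, (this (N + 1)).eq_zero (by simp) (by push_cast; omega)⟩

variable {σ K : Type*} [Field K]

theorem natDegree_aeval_le_of_weightLE {n : σ → ℕ} {P : σ → Polynomial K}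
    (hP : ∀ i, (P i).natDegree ≤ n i) {p : MvPolynomial σ K} {N : ℕ}
    (hp : WeightLE (fun i => (n i : ℤ)) N p) : (aeval P p).natDegree ≤ N := by
  rw [p.as_sum, map_sum]
  refine Polynomial.natDegree_sum_le_of_forall_le _ _ fun e he => ?_
  have h1 := hp e (mem_support_iff.mp he)
  rw [weight_natCast] at h1
  exact (natDegree_aeval_monomial_le hP _ _).trans (by exact_mod_cast h1)

/-- The restriction of a polynomial to the line through the origin in the direction `a`. -/
noncomputable def restrictLine (a : σ → K) : MvPolynomial σ K →ₐ[K] Polynomial K :=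
  aeval fun i => Polynomial.C (a i) * Polynomial.X

theorem natDegree_restrictLine_le (a : σ → K) (p : MvPolynomial σ K) :
    (restrictLine a p).natDegree ≤ p.totalDegree :=
  natDegree_aeval_le_of_weightLE (n := fun _ => 1) (fun _ => (Polynomial.natDegree_C_mul_le _ _).trans Polynomial.natDegree_X_le)
    (weightLE_one_iff.mpr le_rfl)

/-- Here n is only a bound for the degree: t is the form of degree n in p, and its vanishing is what
detects a drop of the degree. -/
theorem exists_leadingForm {p : MvPolynomial σ K} {n : ℕ} (hp : p.totalDegree ≤ n) :
    ∃ t : MvPolynomial σ K, (∀ a, (restrictLine a p).coeff n = eval a t) ∧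
      (t = 0 → p = 0 ∨ p.totalDegree < n) := by
  refine ⟨weightedHomogeneousComponent (fun _ => ((1 : ℕ) : ℤ)) (n : ℤ) p, fun a => ?_, fun h => ?_⟩
  · rw [restrictLine, coeff_aeval_of_weightLE (n := fun _ => 1)
      (fun _ => (Polynomial.natDegree_C_mul_le _ _).trans Polynomial.natDegree_X_le) (weightLE_one_iff.mpr hp)]
    simp
  · have h1 := (weightLE_one_iff.mpr hp).sub_component
    rw [h, sub_zero] at h1
    cases n with
    | zero => exact Or.inl (h1.eq_zero (by simp) (by simp))
    | succ n =>
      right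
      exact Nat.lt_succ_of_le (weightLE_one_iff.mp (h1.mono (by push_cast; omega)))

end MvPolynomial

namespace PolyMap

theorem bind₁_inv_apply (φ : AutC2) (i : Fin 2) : bind₁ (φ⁻¹).1.f (φ.1.f i) = X i := by
  rw [← mul_f, ← Units.val_mul, mul_inv_cancel, Units.val_one, one_f]

theorem bind₁_apply_inv (φ : AutC2) (i : Fin 2) : bind₁ φ.1.f ((φ⁻¹).1.f i) = X i := by
  rw [← mul_f, ← Units.val_mul, inv_mul_cancel, Units.val_one, one_f]

theorem bind₁_bind₁_inv (φ : AutC2) (p : MvPolynomial (Fin 2) ℂ) :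
    bind₁ φ.1.f (bind₁ (φ⁻¹).1.f p) = p := by
  rw [bind₁_bind₁, show (fun i => bind₁ φ.1.f ((φ⁻¹).1.f i)) = X from
    _root_.funext (bind₁_apply_inv φ), bind₁_X_left, AlgHom.id_apply]

theorem bind₁_injective (φ : AutC2) : Function.Injective (bind₁ φ.1.f) := by
  intro p q h
  have := congrArg (bind₁ (φ⁻¹).1.f) h
  have h2 := bind₁_bind₁_inv φ⁻¹
  rw [inv_inv] at h2
  rwa [h2, h2] at this

theorem totalDegree_pos (φ : AutC2) (i : Fin 2) : 0 < (φ.1.f i).totalDegree := by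
  by_contra h
  have h1 := totalDegree_eq_zero_iff_eq_C.mp (Nat.eq_zero_of_not_pos h)
  have h2 := bind₁_inv_apply φ i
  rw [h1, bind₁_C_right] at h2
  have h3 := congrArg totalDegree h2
  simp at h3

/-- The partial derivative `∂ⱼ`, transported by the automorphism `φ`. -/
noncomputable def flow (φ : AutC2) (j : Fin 2) : Fin 2 → MvPolynomial (Fin 2) ℂ :=
  fun k => bind₁ (φ⁻¹).1.f (pderiv j (φ.1.f k))

/-- By the chain rule, φ conjugates the transported derivation to ∂ⱼ; local nilpotency, kernel and
nonvanishing are inherited through this identity. -/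
theorem bind₁_vecDerivation_flow (φ : AutC2) (j : Fin 2) (p : MvPolynomial (Fin 2) ℂ) :
    bind₁ φ.1.f (vecDerivation (flow φ j) p) = pderiv j (bind₁ φ.1.f p) := by
  rw [pderiv_bind₁, vecDerivation_apply, map_sum]
  exact Finset.sum_congr rfl fun k _ => by rw [map_mul, flow, bind₁_bind₁_inv, mul_comm]

theorem isLocallyNilpotent_flow (φ : AutC2) (j : Fin 2) :
    (vecDerivation (flow φ j)).IsLocallyNilpotent := by
  intro p
  obtain ⟨n, hn⟩ := isLocallyNilpotent_pderiv j (bind₁ φ.1.f p)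
  refine ⟨n, bind₁_injective φ ?_⟩
  rw [map_zero, ← hn]
  exact (Function.Semiconj.iterate_right (bind₁_vecDerivation_flow φ j) n) p

theorem vecDerivation_flow_inv (φ : AutC2) {i j : Fin 2} (hij : i ≠ j) :
    vecDerivation (flow φ j) ((φ⁻¹).1.f i) = 0 := by
  apply bind₁_injective φ
  rw [bind₁_vecDerivation_flow, bind₁_apply_inv, map_zero, pderiv_X_of_ne hij]

theorem flow_ne_zero (φ : AutC2) (j : Fin 2) : flow φ j ≠ 0 := by
  intro h
  have h1 := bind₁_vecDerivation_flow φ j ((φ⁻¹).1.f j)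
  rw [h, bind₁_apply_inv, pderiv_X_self, vecDerivation_apply] at h1
  simp at h1

/-- Any monomial containing z₀ has weight at least n 0 ≥ 2. If both components of φ⁻¹ had top weight
below 2, neither would involve z₀, against the chain rule for φ⁻¹ ∘ φ. Weight at least 2 is what
makes the top part cancel when φ is substituted. -/
theorem exists_inv_weight (φ : AutC2) {n : Fin 2 → ℕ} (hn0 : 2 ≤ n 0) :
    ∃ (i : Fin 2) (N : ℕ), 2 ≤ N ∧ WeightLE (fun i => (n i : ℤ)) N ((φ⁻¹).1.f i) ∧
      weightedHomogeneousComponent (fun i => (n i : ℤ)) (N : ℤ) ((φ⁻¹).1.f i) ≠ 0 := by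
  have hne : ∀ i, (φ⁻¹).1.f i ≠ 0 := fun i h => by
    have := totalDegree_pos φ⁻¹ i
    simp [h] at this
  choose N hN hN' using fun i => exists_weightLE_component_ne_zero
    (w := fun i => (n i : ℤ)) (fun i => Int.natCast_nonneg _) (hne i)
  by_contra! h
  have hN2 : ∀ i, N i < 2 := fun i => by
    by_contra hi
    exact hN' i (h i (N i) (by omega) (hN i))
  have hd : ∀ i, pderiv 0 ((φ⁻¹).1.f i) = 0 := by
    intro i
    ext e
    rw [coeff_pderiv, coeff_zero]
    by_contra he
    have h1 := hN i _ (left_ne_zero_of_mul he)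
    have h2 : (0 : ℤ) ≤ Finsupp.weight (fun i => (n i : ℤ)) e := by
      rw [weight_natCast]
      exact Int.natCast_nonneg _
    rw [map_add, Finsupp.weight_single, one_smul] at h1
    have h3 := hN2 i
    omega
  have h1 := congrArg (pderiv 0) (bind₁_inv_apply φ 0)
  rw [pderiv_bind₁, pderiv_X_self, Finset.sum_eq_zero fun k _ => by rw [hd, mul_zero]] at h1
  exact zero_ne_one h1

/-- The degree of one component divides the degree of the other one, and a power of the component
of smaller degree has the same leading form as the other component. -/
theorem exists_totalDegree_sub_lt (φ : AutC2) (hle : (φ.1.f 1).totalDegree ≤ (φ.1.f 0).totalDegree)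
    (h2 : 2 ≤ (φ.1.f 0).totalDegree) :
    (φ.1.f 1).totalDegree ∣ (φ.1.f 0).totalDegree ∧
      ∃ c : ℂ, (φ.1.f 0 - C c * φ.1.f 1 ^ ((φ.1.f 0).totalDegree / (φ.1.f 1).totalDegree)
        ).totalDegree < (φ.1.f 0).totalDegree := by
  set n : Fin 2 → ℕ := ![(φ.1.f 0).totalDegree, (φ.1.f 1).totalDegree] with hn
  have hnf : ∀ i, (φ.1.f i).totalDegree = n i := fun i => by fin_cases i <;> rfl
  choose t ht ht0 using fun i => exists_leadingForm (hnf i).le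
  have ht0 : ∀ i, t i ≠ 0 := by
    intro i h
    rcases ht0 i h with h | h
    · have := totalDegree_pos φ i
      simp [h] at this
    · have := hnf i
      omega
  obtain ⟨i, N, hN2, hN, hN0⟩ := exists_inv_weight φ (n := n) h2
  obtain ⟨j, hij⟩ : ∃ j, i ≠ j := ⟨i + 1, by fin_cases i <;> decide⟩
  obtain ⟨b, hb0, hbn, hb⟩ := exists_leading_vecDerivation (w := fun i => (n i : ℤ))
    (fun i => Int.natCast_nonneg _) (flow_ne_zero φ j) (isLocallyNilpotent_flow φ j)
  set r := weightedHomogeneousComponent (fun i => (n i : ℤ)) (N : ℤ) ((φ⁻¹).1.f i) with hr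
  -- Along a line, substituting φ into the component of φ⁻¹ gives a i · X, with zero coefficient at
  -- N ≥ 2; this coefficient is r at the leading forms.
  have hrt : ∀ a, eval (fun k => eval a (t k)) r = 0 := by
    intro a
    have h1 := coeff_aeval_of_weightLE (n := n) (P := fun k => restrictLine a (φ.1.f k))
      (fun k => (natDegree_restrictLine_le _ _).trans (hnf k).le) hN
    have h3 : aeval (fun k => restrictLine a (φ.1.f k)) ((φ⁻¹).1.f i) = restrictLine a (X i) := by
      rw [← bind₁_apply_inv φ i, bind₁, comp_aeval_apply]
    have h4 : restrictLine a (X i) = Polynomial.C (a i) * Polynomial.X := aeval_X _ _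
    rw [h3, h4, Polynomial.coeff_C_mul, Polynomial.coeff_X,
      if_neg (by omega), mul_zero] at h1
    rw [show (fun k => (restrictLine a (φ.1.f k)).coeff (n k)) = fun k => eval a (t k) from
      _root_.funext fun k => ht k a] at h1
    exact h1.symm
  have hprod : t 0 * t 1 ≠ 0 := mul_ne_zero (ht0 0) (ht0 1)
  have hU : {u : Fin 2 → ℂ | (∀ k, u k ≠ 0) ∧ ∃ a, u = fun k => eval a (t k)}.Nonempty := by
    by_contra hU
    refine hprod (MvPolynomial.funext fun a => ?_)
    rw [map_zero]
    by_contra ha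
    rw [map_mul] at ha
    refine hU ⟨fun k => eval a (t k), fun k => ?_, a, rfl⟩
    fin_cases k
    exacts [left_ne_zero_of_mul ha, right_ne_zero_of_mul ha]
  obtain ⟨hdvd, c, hc⟩ := dvd_of_isLocallyNilpotent hbn
    (fun h => hb0 (_root_.funext fun k => by rw [← vecDerivation_X b k, h]; rfl)) hN0
    (hb N _ hN (vecDerivation_flow_inv φ hij)) (totalDegree_pos φ 1) hle hU (fun u hu => hu.1) (by
      rintro u ⟨-, a, rfl⟩
      have := (weightedHomogeneousComponent_isWeightedHomogeneous (w := fun i => (n i : ℤ)) (N : ℤ)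
        ((φ⁻¹).1.f i)).aeval_curve (fun k => eval a (t k))
      rw [← hr, hrt, map_zero, zero_mul] at this
      exact this)
  refine ⟨hdvd, c, ?_⟩
  set k := (φ.1.f 0).totalDegree / (φ.1.f 1).totalDegree with hk
  have hkn : k * n 1 = n 0 := Nat.div_mul_cancel hdvd
  have hdeg : (φ.1.f 0 - C c * φ.1.f 1 ^ k).totalDegree ≤ n 0 := by
    refine (totalDegree_sub _ _).trans (max_le le_rfl ?_)
    refine (totalDegree_mul _ _).trans ?_
    rw [totalDegree_C, zero_add, ← hkn]
    exact totalDegree_pow _ _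
  obtain ⟨s, hs, hs0⟩ := exists_leadingForm hdeg
  -- The relation t 0 = c · t 1 ^ k is known only where both leading forms are nonzero; multiplying
  -- by their product extends the vanishing of s to all points.
  have hst : s * (t 0 * t 1) = 0 := by
    refine MvPolynomial.funext fun a => ?_
    rw [map_zero, map_mul]
    by_cases ha : eval a (t 0 * t 1) = 0
    · rw [ha, mul_zero]
    rw [← hs a, map_sub, Polynomial.coeff_sub, map_mul, algHom_C, Polynomial.algebraMap_eq,
      Polynomial.coeff_C_mul, map_pow, ← hkn,
      Polynomial.coeff_pow_of_natDegree_le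
        ((natDegree_restrictLine_le a (φ.1.f 1)).trans (hnf 1).le), hkn, ht 0, ht 1]
    rw [map_mul] at ha
    have h4 := hc (fun k => eval a (t k)) ⟨fun k => by
      fin_cases k
      exacts [left_ne_zero_of_mul ha, right_ne_zero_of_mul ha], a, rfl⟩
    rw [h4, sub_self, zero_mul]
  rcases hs0 ((mul_eq_zero.mp hst).resolve_right hprod) with h | h
  · rw [h, totalDegree_zero]
    omega
  · exact h

end PolyMap

end ComponentDegrees

/-! ### Elementary automorphisms and the reduction of the degree -/

section Reduction

namespace PolyMap

/-- The polynomial map `(z₀, z₁) ↦ (α z₀ + P(z₁), β z₁ + γ)`. -/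
noncomputable def elementary (α β γ : ℂ) (P : Polynomial ℂ) : PolyMap :=
  ⟨![C α * X 0 + Polynomial.aeval (X 1) P, C β * X 1 + C γ]⟩

theorem elementary_mul (α β γ α' β' γ' : ℂ) (P P' : Polynomial ℂ) :
    elementary α β γ P * elementary α' β' γ' P' =
      elementary (α * α') (β * β') (β * γ' + γ)
        (Polynomial.C α * P' + P.comp (Polynomial.C β' * Polynomial.X + Polynomial.C γ')) := by
  refine PolyMap.ext (_root_.funext fun i => ?_)
  rw [mul_f]
  fin_cases i
  · have h : bind₁ (elementary α' β' γ' P').f (Polynomial.aeval (X 1) P) =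
        Polynomial.aeval (C β' * X 1 + C γ') P := by
      rw [← Polynomial.aeval_algHom_apply, bind₁_X_right]
      rfl
    have h1 : (elementary α β γ P).f 0 = C α * X 0 + Polynomial.aeval (X 1) P := rfl
    have h2 : (elementary α' β' γ' P').f 0 = C α' * X 0 + Polynomial.aeval (X 1) P' := rfl
    simp only [Fin.zero_eta, h1, map_add, map_mul, bind₁_C_right, bind₁_X_right, h, h2]
    simp only [elementary, Matrix.cons_val_zero, map_add, map_mul, Polynomial.aeval_C,
      algebraMap_eq, Polynomial.aeval_comp, Polynomial.aeval_X]
    ring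
  · have h1 : (elementary α β γ P).f 1 = C β * X 1 + C γ := rfl
    have h2 : (elementary α' β' γ' P').f 1 = C β' * X 1 + C γ' := rfl
    simp only [Fin.mk_one, h1, map_add, map_mul, bind₁_C_right, bind₁_X_right, h2]
    simp only [elementary, Matrix.cons_val_one, Matrix.cons_val_fin_one, map_add, map_mul]
    ring

theorem elementary_one : elementary 1 1 0 0 = 1 := by
  refine PolyMap.ext (_root_.funext fun i => ?_)
  fin_cases i <;> simp [elementary, one_f]

end PolyMap

/-- The automorphism `(z₀, z₁) ↦ (α z₀ + P(z₁), β z₁ + γ)`. -/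
noncomputable def elementaryAut (α β : ℂˣ) (γ : ℂ) (P : Polynomial ℂ) : AutC2 where
  val := PolyMap.elementary α β γ P
  inv := PolyMap.elementary (α⁻¹ : ℂˣ) (β⁻¹ : ℂˣ) (-((β⁻¹ : ℂˣ) * γ))
    (-(Polynomial.C ((α⁻¹ : ℂˣ) : ℂ) * P.comp (Polynomial.C ((β⁻¹ : ℂˣ) : ℂ) * Polynomial.X +
      Polynomial.C (-((β⁻¹ : ℂˣ) * γ)))))
  val_inv := by
    rw [PolyMap.elementary_mul, ← PolyMap.elementary_one]
    congr 1
    · simp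
    · simp
    · simp
    · rw [mul_neg, ← mul_assoc, ← Polynomial.C_mul]
      simp
  inv_val := by
    rw [PolyMap.elementary_mul, ← PolyMap.elementary_one]
    congr 1
    · simp
    · simp
    · simp
    · have h : (Polynomial.C ((β⁻¹ : ℂˣ) : ℂ) * Polynomial.X +
          Polynomial.C (-((β⁻¹ : ℂˣ) * γ))).comp (Polynomial.C (β : ℂ) * Polynomial.X +
            Polynomial.C γ) = Polynomial.X := by
        rw [Polynomial.add_comp, Polynomial.mul_comp, Polynomial.C_comp, Polynomial.X_comp,
          Polynomial.C_comp, mul_add, ← mul_assoc, ← Polynomial.C_mul, ← Polynomial.C_mul,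
          add_assoc, ← Polynomial.C_add]
        simp
      rw [Polynomial.neg_comp, Polynomial.mul_comp, Polynomial.comp_assoc, h]
      simp

theorem elementaryAut_mul (α β : ℂˣ) (γ : ℂ) (P : Polynomial ℂ) (α' β' : ℂˣ) (γ' : ℂ)
    (P' : Polynomial ℂ) : elementaryAut α β γ P * elementaryAut α' β' γ' P' =
      elementaryAut (α * α') (β * β') (β * γ' + γ) (Polynomial.C (α : ℂ) * P' +
        P.comp (Polynomial.C (β' : ℂ) * Polynomial.X + Polynomial.C γ')) :=
  Units.ext (PolyMap.elementary_mul _ _ _ _ _ _ _ _)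

theorem elementaryAut_one : elementaryAut 1 1 0 0 = 1 := Units.ext PolyMap.elementary_one

theorem isElementaryAut_elementaryAut (α β : ℂˣ) (γ : ℂ) (P : Polynomial ℂ) :
    IsElementaryAut (elementaryAut α β γ P) := by
  have hX : ∀ i j : Fin 2, i ≤ j → (X j : MvPolynomial (Fin 2) ℂ) ∈ supported ℂ {j | i ≤ j} :=
    fun i j hij => X_mem_supported.mpr hij
  have hC : ∀ (i : Fin 2) (c : ℂ), (C c : MvPolynomial (Fin 2) ℂ) ∈ supported ℂ {j | i ≤ j} :=
    fun i c => Subalgebra.algebraMap_mem _ c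
  intro i
  fin_cases i
  · exact add_mem (mul_mem (hC _ _) (hX 0 0 le_rfl))
      (Algebra.adjoin_le (Set.singleton_subset_iff.mpr (hX 0 1 (by decide)))
        (Polynomial.aeval_mem_adjoin_singleton ℂ _))
  · exact add_mem (mul_mem (hC _ _) (hX 1 1 le_rfl)) (hC _ _)

/-- The shear `(z₀, z₁) ↦ (z₀ + P(z₁), z₁)`. -/
noncomputable def shear (P : Polynomial ℂ) : AutC2 := elementaryAut 1 1 0 P

theorem shear_mul (P Q : Polynomial ℂ) : shear P * shear Q = shear (Q + P) := by
  simp [shear, elementaryAut_mul]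

theorem shear_zero : shear 0 = 1 := elementaryAut_one

theorem shear_mul_shear_neg (P : Polynomial ℂ) : shear P * shear (-P) = 1 := by
  rw [shear_mul, neg_add_cancel, shear_zero]

theorem shear_mul_f_zero (P : Polynomial ℂ) (φ : AutC2) :
    (shear P * φ).1.f 0 = φ.1.f 0 + Polynomial.aeval (φ.1.f 1) P := by
  rw [Units.val_mul, PolyMap.mul_f, show (shear P).1.f 0 =
    C ((1 : ℂˣ) : ℂ) * X 0 + Polynomial.aeval (X 1) P from rfl, map_add, ←
    Polynomial.aeval_algHom_apply]
  simp

theorem shear_mul_f_one (P : Polynomial ℂ) (φ : AutC2) : (shear P * φ).1.f 1 = φ.1.f 1 := by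
  rw [Units.val_mul, PolyMap.mul_f, show (shear P).1.f 1 =
    C ((1 : ℂˣ) : ℂ) * X 1 + C 0 from rfl]
  simp

/-- The automorphism `(z₀, z₁) ↦ (z₁, z₀)`. -/
noncomputable def swapAut : AutC2 where
  val := ⟨![X 1, X 0]⟩
  inv := ⟨![X 1, X 0]⟩
  val_inv := PolyMap.ext (_root_.funext fun i => by
    rw [PolyMap.mul_f]; fin_cases i <;> simp [PolyMap.one_f])
  inv_val := PolyMap.ext (_root_.funext fun i => by
    rw [PolyMap.mul_f]; fin_cases i <;> simp [PolyMap.one_f])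

theorem swapAut_mul_self : swapAut * swapAut = 1 := Units.ext swapAut.val_inv

theorem swapAut_mul_f_zero (φ : AutC2) : (swapAut * φ).1.f 0 = φ.1.f 1 := by
  rw [Units.val_mul, PolyMap.mul_f, show swapAut.1.f 0 = X 1 from rfl, bind₁_X_right]

theorem swapAut_mul_f_one (φ : AutC2) : (swapAut * φ).1.f 1 = φ.1.f 0 := by
  rw [Units.val_mul, PolyMap.mul_f, show swapAut.1.f 1 = X 0 from rfl, bind₁_X_right]

theorem MvPolynomial.eq_affine_of_totalDegree_le_one {σ R : Type*} [Fintype σ] [CommRing R]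
    {p : MvPolynomial σ R} (hp : p.totalDegree ≤ 1) :
    p = ∑ j, C (coeff (Finsupp.single j 1) p) * X j + C (coeff 0 p) := by
  classical
  ext e
  simp only [coeff_add, coeff_sum, coeff_C_mul, coeff_X, coeff_C]
  by_cases h0 : e = 0
  · subst h0
    simp
  by_cases h1 : ∃ j, e = Finsupp.single j 1
  · obtain ⟨j, rfl⟩ := h1
    rw [Finset.sum_eq_single j]
    · simp [Ne.symm h0]
    · intro i _ hij
      simp [Finsupp.single_left_inj, hij]
    · simp
  · rw [if_neg (Ne.symm h0), add_zero, Finset.sum_eq_zero fun j _ => by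
      rw [if_neg fun h => h1 ⟨j, h.symm⟩, mul_zero]]
    by_contra he
    have h2 := (le_totalDegree (mem_support_iff.mpr he)).trans hp
    obtain ⟨j, hj⟩ := Finsupp.ne_iff.mp h0
    have hj' : 1 ≤ e j := Nat.one_le_iff_ne_zero.mpr hj
    have h3 : (e.sum fun _ k => k) = ∑ i, e i := Finsupp.sum_fintype _ _ fun _ => rfl
    rw [h3, ← Finset.add_sum_erase _ _ (Finset.mem_univ j)] at h2
    refine h1 ⟨j, Finsupp.ext fun i => ?_⟩
    rw [Finsupp.single_apply]
    split_ifs with hij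
    · subst hij
      omega
    · have := Finset.single_le_sum (f := fun i => e i) (fun _ _ => Nat.zero_le _)
        (Finset.mem_erase.mpr ⟨Ne.symm hij, Finset.mem_univ i⟩)
      omega

theorem isAffineAut_of_degree_le_one {φ : AutC2} (h : φ.1.degree ≤ 1) : IsAffineAut φ := by
  have hf : ∀ i, φ.1.f i = ∑ j, C (coeff (Finsupp.single j 1) (φ.1.f i)) * X j +
      C (coeff 0 (φ.1.f i)) := by
    intro i
    refine MvPolynomial.eq_affine_of_totalDegree_le_one (le_trans ?_ h)
    fin_cases i
    exacts [le_max_left _ _, le_max_right _ _]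
  set A : Matrix (Fin 2) (Fin 2) ℂ := Matrix.of fun i j => coeff (Finsupp.single j 1) (φ.1.f i)
  -- A left kernel vector of A would make a nontrivial combination of the components constant;
  -- applying φ⁻¹ makes the same combination of coordinates constant.
  have hA : A.det ≠ 0 := by
    intro hdet
    obtain ⟨v, hv0, hv⟩ := Matrix.exists_vecMul_eq_zero_iff.mpr hdet
    have h1 : ∑ i, C (v i) * φ.1.f i = C (∑ i, v i * coeff 0 (φ.1.f i)) := by
      have h2 : ∀ j, ∑ i, v i * coeff (Finsupp.single j 1) (φ.1.f i) = 0 := fun j => congrFun hv j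
      have h3 : ∑ i, C (v i) * φ.1.f i = ∑ j, C (∑ i, v i * coeff (Finsupp.single j 1) (φ.1.f i)) *
          X j + C (∑ i, v i * coeff 0 (φ.1.f i)) := by
        conv_lhs => rw [Finset.sum_congr rfl fun i _ => by rw [hf i]]
        simp only [Fin.sum_univ_two, map_add, map_mul]
        ring
      rw [h3]
      simp [h2]
    have h4 := congrArg (bind₁ (φ⁻¹).1.f) h1
    simp only [map_sum, map_mul, bind₁_C_right, PolyMap.bind₁_inv_apply] at h4
    apply hv0
    funext j
    have h5 := congrArg (coeff (Finsupp.single j 1)) h4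
    simp only [Fin.sum_univ_two, coeff_add, coeff_C_mul, coeff_X, ← map_mul, ← map_add, coeff_C,
      Finsupp.single_left_inj (one_ne_zero : (1 : ℕ) ≠ 0)] at h5
    have h6 : (0 : Fin 2 →₀ ℕ) ≠ Finsupp.single j 1 := fun h => by
      simpa using DFunLike.congr_fun h j
    rw [if_neg h6] at h5
    fin_cases j <;> simpa using h5
  exact ⟨Matrix.GeneralLinearGroup.mkOfDetNeZero A hA, fun i => coeff 0 (φ.1.f i), hf⟩

/-- A shear lowers the degree of the first component to at most that of the second one. -/
theorem exists_shear_totalDegree_le (φ : AutC2)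
    (hle : (φ.1.f 1).totalDegree ≤ (φ.1.f 0).totalDegree) :
    ∃ P, ((shear P * φ).1.f 0).totalDegree ≤ (φ.1.f 1).totalDegree := by
  induction hn : (φ.1.f 0).totalDegree using Nat.strong_induction_on generalizing φ with
  | _ n ih =>
    rcases hle.eq_or_lt with h | h
    · exact ⟨0, by rw [shear_zero, one_mul, h]⟩
    have h2 : 2 ≤ (φ.1.f 0).totalDegree := by
      have := PolyMap.totalDegree_pos φ 1
      omega
    obtain ⟨-, c, hc⟩ := PolyMap.exists_totalDegree_sub_lt φ hle h2
    set Q : Polynomial ℂ := -(Polynomial.C c *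
      Polynomial.X ^ ((φ.1.f 0).totalDegree / (φ.1.f 1).totalDegree)) with hQ
    have hQ0 : (shear Q * φ).1.f 0 = φ.1.f 0 - C c *
        φ.1.f 1 ^ ((φ.1.f 0).totalDegree / (φ.1.f 1).totalDegree) := by
      rw [shear_mul_f_zero, hQ, sub_eq_add_neg]
      simp [algebraMap_eq]
    rw [← hQ0] at hc
    rcases le_total ((φ.1.f 1).totalDegree) ((shear Q * φ).1.f 0).totalDegree with h3 | h3
    · obtain ⟨P, hP⟩ := ih _ (hn ▸ hc) (shear Q * φ) (by rwa [shear_mul_f_one]) rfl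
      rw [shear_mul_f_one, ← mul_assoc, shear_mul] at hP
      exact ⟨_, hP⟩
    · exact ⟨Q, h3⟩

/-- The sheared map has exactly the degree of the second component, a proper divisor of that of the
first; hence the factor 2. -/
theorem exists_shear_degree (φ : AutC2)
    (hlt : (φ.1.f 1).totalDegree < (φ.1.f 0).totalDegree) :
    ∃ P, (shear P * φ).1.degree ∣ φ.1.degree ∧ 2 * (shear P * φ).1.degree ≤ φ.1.degree := by
  have hpos := PolyMap.totalDegree_pos φ 1
  obtain ⟨P, hP⟩ := exists_shear_totalDegree_le φ hlt.le
  have h1 : (shear P * φ).1.degree = (φ.1.f 1).totalDegree := by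
    rw [PolyMap.degree, shear_mul_f_one, max_eq_right hP]
  have h2 : φ.1.degree = (φ.1.f 0).totalDegree := max_eq_left hlt.le
  obtain ⟨⟨k, hk⟩, -⟩ := PolyMap.exists_totalDegree_sub_lt φ hlt.le (by omega)
  refine ⟨P, ?_⟩
  rw [h1, h2]
  refine ⟨⟨k, hk⟩, ?_⟩
  have : 2 ≤ k := by
    by_contra hk2
    have : (φ.1.f 1).totalDegree * k ≤ (φ.1.f 1).totalDegree * 1 := Nat.mul_le_mul_left _ (by omega)
    omega
  rw [hk, mul_comm]
  exact Nat.mul_le_mul_left _ this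

theorem totalDegree_C_mul_X_le (c : ℂ) (i : Fin 2) :
    (C c * X i : MvPolynomial (Fin 2) ℂ).totalDegree ≤ 1 := by
  refine (totalDegree_mul _ _).trans ?_
  simp

theorem isAffineAut_swapAut : IsAffineAut swapAut :=
  isAffineAut_of_degree_le_one (by simp [PolyMap.degree, swapAut])

theorem isAffineAut_shear_mul_swapAut (c : ℂ) :
    IsAffineAut (shear (Polynomial.C c * Polynomial.X) * swapAut) := by
  refine isAffineAut_of_degree_le_one ?_
  rw [PolyMap.degree, shear_mul_f_zero, shear_mul_f_one]
  simp only [swapAut, Matrix.cons_val_zero, Matrix.cons_val_one, map_mul, Polynomial.aeval_C,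
    Polynomial.aeval_X, algebraMap_eq]
  exact max_le ((totalDegree_add _ _).trans
    (max_le (by simp) (totalDegree_C_mul_X_le _ _))) (by simp)

theorem isAffineAut_one : IsAffineAut 1 :=
  isAffineAut_of_degree_le_one (by simp [PolyMap.degree, PolyMap.one_f])

/-- An automorphism of degree at least two is the composition of an affine automorphism, an
elementary automorphism and an automorphism whose degree is a proper divisor. -/
theorem exists_affine_mul_elementary_mul (φ : AutC2) (hφ : 2 ≤ φ.1.degree) :
    ∃ a e ψ : AutC2, φ = a * e * ψ ∧ IsAffineAut a ∧ IsElementaryAut e ∧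
      ψ.1.degree ∣ φ.1.degree ∧ 2 * ψ.1.degree ≤ φ.1.degree := by
  have key : ∀ φ : AutC2, (φ.1.f 1).totalDegree < (φ.1.f 0).totalDegree →
      ∃ e ψ : AutC2, φ = e * ψ ∧ IsElementaryAut e ∧
      ψ.1.degree ∣ φ.1.degree ∧ 2 * ψ.1.degree ≤ φ.1.degree := by
    intro φ h
    obtain ⟨P, hP, hP'⟩ := exists_shear_degree φ h
    refine ⟨shear (-P), shear P * φ, ?_, isElementaryAut_elementaryAut _ _ _ _, hP, hP'⟩
    have := shear_mul_shear_neg (-P)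
    rw [neg_neg] at this
    rw [← mul_assoc, this, one_mul]
  have key' : ∀ φ : AutC2, (φ.1.f 0).totalDegree < (φ.1.f 1).totalDegree →
      ∃ e ψ : AutC2, φ = swapAut * e * ψ ∧ IsElementaryAut e ∧
      ψ.1.degree ∣ φ.1.degree ∧ 2 * ψ.1.degree ≤ φ.1.degree := by
    intro φ h
    obtain ⟨e, ψ, h1, h2, h3, h4⟩ := key (swapAut * φ)
      (by rwa [swapAut_mul_f_zero, swapAut_mul_f_one])
    have h5 : (swapAut * φ).1.degree = φ.1.degree := by
      rw [PolyMap.degree, swapAut_mul_f_zero, swapAut_mul_f_one, PolyMap.degree, max_comm]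
    rw [h5] at h3 h4
    exact ⟨e, ψ, by rw [mul_assoc, ← h1, ← mul_assoc, swapAut_mul_self, one_mul], h2, h3, h4⟩
  rcases lt_trichotomy (φ.1.f 1).totalDegree (φ.1.f 0).totalDegree with h | h | h
  · obtain ⟨e, ψ, h1, h2⟩ := key φ h
    exact ⟨1, e, ψ, by rwa [one_mul], isAffineAut_one, h2⟩
  -- For equal degrees the quotient is 1, so subtracting c · φ₁ is a linear shear. It makes the
  -- first component the smaller one and is absorbed in the affine factor.
  · have hd : φ.1.degree = (φ.1.f 1).totalDegree := max_eq_right h.ge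
    obtain ⟨-, c, hc⟩ := PolyMap.exists_totalDegree_sub_lt φ h.le (by omega)
    rw [h, Nat.div_self (PolyMap.totalDegree_pos φ 0), pow_one] at hc
    set Q : Polynomial ℂ := Polynomial.C c * Polynomial.X with hQ
    have hQ0 : (shear (-Q) * φ).1.f 0 = φ.1.f 0 - C c * φ.1.f 1 := by
      rw [shear_mul_f_zero, hQ, sub_eq_add_neg]
      simp [algebraMap_eq]
    obtain ⟨e, ψ, h1, h2, h3, h4⟩ := key' (shear (-Q) * φ) (by
      rw [hQ0, shear_mul_f_one, h]
      exact hc)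
    have h5 : (shear (-Q) * φ).1.degree = φ.1.degree := by
      rw [PolyMap.degree, hQ0, shear_mul_f_one, hd, h]
      exact max_eq_right hc.le
    rw [h5] at h3 h4
    refine ⟨shear Q * swapAut, e, ψ, ?_, isAffineAut_shear_mul_swapAut c, h2, h3, h4⟩
    rw [mul_assoc, mul_assoc, ← mul_assoc swapAut, ← h1, ← mul_assoc, shear_mul_shear_neg, one_mul]
  · obtain ⟨e, ψ, h1, h2⟩ := key' φ h
    exact ⟨swapAut, e, ψ, h1, isAffineAut_swapAut, h2⟩

/-- An elementary automorphism has the form `(α z₀ + P(z₁), β z₁ + γ)`. -/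
theorem IsElementaryAut.exists_eq {φ : AutC2} (hφ : IsElementaryAut φ) :
    ∃ α β γ P, φ = elementaryAut α β γ P := by
  have hker : ∀ p : MvPolynomial (Fin 2) ℂ, pderiv 0 p = 0 →
      ∃ P : Polynomial ℂ, p = Polynomial.aeval (X 1) P := by
    intro p hp
    have h0 : ∀ e, coeff e p ≠ 0 → e 0 = 0 := by
      intro e he
      by_contra h
      have h1 := coeff_pderiv (i := 0) p (e - Finsupp.single 0 1)
      rw [hp, coeff_zero, tsub_add_cancel_of_le (by simpa using Nat.one_le_iff_ne_zero.mpr h)] at h1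
      exact mul_ne_zero he (Nat.cast_add_one_ne_zero _) h1.symm
    refine ⟨∑ e ∈ p.support, Polynomial.C (coeff e p) * Polynomial.X ^ e 1, ?_⟩
    conv_lhs => rw [p.as_sum]
    rw [map_sum]
    refine Finset.sum_congr rfl fun e he => ?_
    rw [monomial_eq, Finsupp.prod_fintype _ _ (fun i => pow_zero _), Fin.prod_univ_two,
      h0 e (mem_support_iff.mp he)]
    simp [algebraMap_eq]
  have h10 : pderiv 0 (φ.1.f 1) = 0 := by
    refine pderiv_eq_zero_of_notMem_vars fun h => ?_
    have := (mem_supported.mp (hφ 1)) h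
    simp at this
  have hsum : ∀ i, ∑ k, bind₁ φ.1.f (pderiv k ((φ⁻¹).1.f i)) * pderiv i (φ.1.f k) = 1 := fun i => by
    rw [← pderiv_bind₁, PolyMap.bind₁_apply_inv, pderiv_X_self]
  have hsum' : ∑ k, bind₁ φ.1.f (pderiv k ((φ⁻¹).1.f 1)) * pderiv 0 (φ.1.f k) = 0 := by
    rw [← pderiv_bind₁, PolyMap.bind₁_apply_inv, pderiv_X_of_ne (by decide)]
  have hs0 := hsum 0
  have hs1 := hsum 1
  rw [Fin.sum_univ_two, h10, mul_zero, add_zero] at hs0 hsum'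
  -- As φ₁ does not involve z₀, the chain rule for φ⁻¹ ∘ φ exhibits ∂₀φ₀ as a unit, hence a
  -- constant.
  obtain ⟨α, hα, h00⟩ := isUnit_iff_eq_C_of_isReduced.mp (IsUnit.of_mul_eq_one_right _ hs0)
  have h2 : bind₁ φ.1.f (pderiv 0 ((φ⁻¹).1.f 1)) = 0 := by
    refine (mul_eq_zero.mp hsum').resolve_right ?_
    rw [h00]
    simpa using hα.ne_zero
  rw [Fin.sum_univ_two, h2, zero_mul, zero_add] at hs1
  obtain ⟨β, hβ, h11⟩ := isUnit_iff_eq_C_of_isReduced.mp (IsUnit.of_mul_eq_one_right _ hs1)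
  obtain ⟨P, hP⟩ := hker (φ.1.f 0 - C α * X 0) (by rw [map_sub, pderiv_C_mul, h00]; simp)
  obtain ⟨Q, hQ⟩ := hker (φ.1.f 1 - C β * X 1) (by rw [map_sub, pderiv_C_mul, h10]; simp)
  have hQ1 : Polynomial.derivative Q = 0 := by
    have h3 : pderiv 1 (φ.1.f 1 - C β * X 1) = 0 := by rw [map_sub, pderiv_C_mul, h11]; simp
    rw [hQ, Derivation.map_aeval, pderiv_X_self, smul_eq_mul, mul_one] at h3
    have h4 := congrArg (aeval fun _ => (Polynomial.X : Polynomial ℂ)) h3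
    rwa [← Polynomial.aeval_algHom_apply, aeval_X, map_zero, Polynomial.aeval_X_left_apply] at h4
  obtain ⟨γ, hγ⟩ : ∃ γ, Q = Polynomial.C γ := ⟨_, Polynomial.eq_C_of_derivative_eq_zero hQ1⟩
  refine ⟨hα.unit, hβ.unit, γ, P, Units.ext (PolyMap.ext (_root_.funext fun i => ?_))⟩
  fin_cases i
  · exact (sub_eq_iff_eq_add'.mp hP)
  · rw [hγ, Polynomial.aeval_C] at hQ
    exact (sub_eq_iff_eq_add'.mp hQ)

end Reduction

/-! ### Products of involutions -/

section InvolutionProducts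

variable {G : Type*} [Group G]

/-- `g` is a product of at most `n` elements of `H` of order at most two. -/
def IsInvolutionProduct (H : Set G) (n : ℕ) (g : G) : Prop :=
  ∃ l : List G, (∀ s ∈ l, s ∈ H ∧ s * s = 1) ∧ l.prod = g ∧ l.length ≤ n

variable {H : Set G} {m n : ℕ} {g h : G}

theorem IsInvolutionProduct.mul (hg : IsInvolutionProduct H m g) (hh : IsInvolutionProduct H n h) :
    IsInvolutionProduct H (m + n) (g * h) := by
  obtain ⟨l, hl, rfl, hlm⟩ := hg
  obtain ⟨l', hl', rfl, hln⟩ := hh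
  refine ⟨l ++ l', fun s hs => ?_, List.prod_append, by rw [List.length_append]; omega⟩
  rcases List.mem_append.mp hs with hs | hs
  exacts [hl s hs, hl' s hs]

theorem IsInvolutionProduct.mono {H' : Set G} (hg : IsInvolutionProduct H m g) (hH : H ⊆ H')
    (hmn : m ≤ n) : IsInvolutionProduct H' n g := by
  obtain ⟨l, hl, hg, hlm⟩ := hg
  exact ⟨l, fun s hs => ⟨hH (hl s hs).1, (hl s hs).2⟩, hg, hlm.trans hmn⟩

theorem IsInvolutionProduct.of_mul_self (hg : g ∈ H) (h : g * g = 1) :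
    IsInvolutionProduct H 1 g :=
  ⟨[g], by simpa using ⟨hg, h⟩, by simp, by simp⟩

theorem IsInvolutionProduct.conj {H : Subgroup G} (hg : IsInvolutionProduct (H : Set G) n g)
    {x : G} (hx : x ∈ H) : IsInvolutionProduct (H : Set G) n (x * g * x⁻¹) := by
  obtain ⟨l, hl, rfl, hlm⟩ := hg
  refine ⟨l.map (MulAut.conj x), fun s hs => ?_, ?_, by rwa [List.length_map]⟩
  · obtain ⟨t, ht, rfl⟩ := List.mem_map.mp hs
    refine ⟨?_, by rw [← map_mul, (hl t ht).2, map_one]⟩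
    exact H.mul_mem (H.mul_mem hx (hl t ht).1) (H.inv_mem hx)
  · rw [← map_list_prod, MulAut.conj_apply]

/-- Identity factors, allowed so that degenerate parameters need no separate case, are discarded
here; the others have order exactly two. -/
theorem IsInvolutionProduct.invLength_le (hg : IsInvolutionProduct H n g) : invLength g H ≤ n := by
  classical
  obtain ⟨l, hl, rfl, hln⟩ := hg
  have h : ∀ l : List G, (l.filter (· ≠ 1)).prod = l.prod := by
    intro l
    induction l with
    | nil => rfl
    | cons a l ih =>
      by_cases ha : a = 1
      · subst ha
        simpa using ih
      · rw [List.filter_cons_of_pos (by simpa using ha), List.prod_cons, List.prod_cons, ih]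
  refine le_trans (b := ((l.filter (· ≠ 1)).length : ℕ∞)) (sInf_le ?_)
    (by exact_mod_cast (List.length_filter_le _ _).trans hln)
  refine ⟨l.filter (· ≠ 1), fun s hs => ?_, h l, rfl⟩
  obtain ⟨h1, h2⟩ := List.mem_filter.mp hs
  exact ⟨(hl s h1).1, orderOf_eq_prime (by rw [pow_two, (hl s h1).2]) (by simpa using h2)⟩

end InvolutionProducts

/-! ### Projective automorphisms as products of involutions -/

section Projective

theorem linearMap_eq_of_smul {A B : GL (Fin 3) ℂ} {c : ℂ} (h : A.1 = c • B.1) :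
    linearMap A = linearMap B := by
  refine Units.ext (Quotient.sound fun i j => ?_)
  have hF : ∀ i, (linearTriple A).F i = C c * (linearTriple B).F i := fun i => by
    simp only [linearTriple, h, Matrix.smul_apply, smul_eq_mul, map_mul, Finset.mul_sum, mul_assoc]
  rw [hF, hF]
  ring

theorem isInvolutionProduct_linearMap_two {M : GL (Fin 3) ℂ} (S T : Matrix (Fin 3) (Fin 3) ℂ)
    (hS : S * S = 1) (hT : T * T = 1) (h : S * T = M.1) :
    IsInvolutionProduct (AutP2 : Set BirP2) 2 (linearMap M) := by
  let S' : GL (Fin 3) ℂ := ⟨S, S, hS, hS⟩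
  let T' : GL (Fin 3) ℂ := ⟨T, T, hT, hT⟩
  have hM : M = S' * T' := Units.ext h.symm
  have key : ∀ A : GL (Fin 3) ℂ, A * A = 1 →
      IsInvolutionProduct (AutP2 : Set BirP2) 1 (linearMap A) := fun A hA =>
    IsInvolutionProduct.of_mul_self ⟨A, rfl⟩ (by rw [← map_mul, hA, map_one])
  rw [hM, map_mul]
  exact (key S' (Units.ext hS)).mul (key T' (Units.ext hT))

/-- The invertible upper triangular matrix with last diagonal entry `1`. -/
noncomputable def triangularGL (x y : ℂˣ) (c p q : ℂ) : GL (Fin 3) ℂ :=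
  Matrix.GeneralLinearGroup.mkOfDetNeZero !![(x : ℂ), c, p; 0, y, q; 0, 0, 1] (by
    simp [Matrix.det_fin_three])

/-- Rescaled to determinant 1, the matrix is diag(s, s⁻¹, 1) · diag(1, r⁻¹, r) with s = r x. Each
factor is a product of two antidiagonal involutions of a coordinate plane. -/
theorem isInvolutionProduct_diagonal (x y : ℂˣ) :
    IsInvolutionProduct (AutP2 : Set BirP2) 4 (linearMap (triangularGL x y 0 0 0)) := by
  -- The scaling factor must satisfy r³xy = 1.
  obtain ⟨r, hr⟩ := IsAlgClosed.exists_pow_nat_eq ((x : ℂ) * y)⁻¹ (n := 3) (by norm_num)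
  have hx := x.ne_zero
  have hy := y.ne_zero
  have hr0 : r ≠ 0 := by
    rintro rfl
    have : ((x : ℂ) * y)⁻¹ ≠ 0 := inv_ne_zero (mul_ne_zero hx hy)
    exact this (by rw [← hr]; simp)
  have hr' : r ^ 3 * (x * y) = 1 := by rw [hr, inv_mul_cancel₀ (mul_ne_zero hx hy)]
  let D₁ : GL (Fin 3) ℂ := Matrix.GeneralLinearGroup.mkOfDetNeZero
    !![r * x, 0, 0; 0, (r * x)⁻¹, 0; 0, 0, 1] (by simp [Matrix.det_fin_three, hr0])
  let D₂ : GL (Fin 3) ℂ := Matrix.GeneralLinearGroup.mkOfDetNeZero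
    !![1, 0, 0; 0, r⁻¹, 0; 0, 0, r] (by simp [Matrix.det_fin_three, hr0])
  have h1 : IsInvolutionProduct (AutP2 : Set BirP2) 2 (linearMap D₁) := by
    refine isInvolutionProduct_linearMap_two !![0, r * x, 0; (r * x)⁻¹, 0, 0; 0, 0, 1]
      !![0, 1, 0; 1, 0, 0; 0, 0, 1] ?_ ?_ ?_
    · have e₁ : r * x * ((x : ℂ)⁻¹ * r⁻¹) = 1 := by field_simp
      have e₂ : (x : ℂ)⁻¹ * r⁻¹ * (r * x) = 1 := by field_simp
      ext i j; fin_cases i <;> fin_cases j <;>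
        simp [Matrix.mul_apply, Fin.sum_univ_three, e₁, e₂]
    · ext i j; fin_cases i <;> fin_cases j <;> simp [Matrix.mul_apply, Fin.sum_univ_three]
    · ext i j; fin_cases i <;> fin_cases j <;>
        simp [Matrix.mul_apply, Fin.sum_univ_three, D₁, Matrix.GeneralLinearGroup.mkOfDetNeZero]
  have h2 : IsInvolutionProduct (AutP2 : Set BirP2) 2 (linearMap D₂) := by
    refine isInvolutionProduct_linearMap_two !![1, 0, 0; 0, 0, r⁻¹; 0, r, 0]
      !![1, 0, 0; 0, 0, 1; 0, 1, 0] ?_ ?_ ?_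
    · ext i j; fin_cases i <;> fin_cases j <;> simp [Matrix.mul_apply, Fin.sum_univ_three, hr0]
    · ext i j; fin_cases i <;> fin_cases j <;> simp [Matrix.mul_apply, Fin.sum_univ_three]
    · ext i j; fin_cases i <;> fin_cases j <;>
        simp [Matrix.mul_apply, Fin.sum_univ_three, D₂, Matrix.GeneralLinearGroup.mkOfDetNeZero]
  have h3 : (D₁ * D₂).1 = r • (triangularGL x y 0 0 0).1 := by
    have h4 : (x : ℂ)⁻¹ * r⁻¹ * r⁻¹ = r * y := by
      field_simp
      linear_combination -hr'
    ext i j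
    fin_cases i <;> fin_cases j <;>
      simp [Matrix.mul_apply, Fin.sum_univ_three, D₁, D₂, triangularGL,
        Matrix.GeneralLinearGroup.mkOfDetNeZero, h4]
  rw [← linearMap_eq_of_smul h3, map_mul]
  exact h1.mul h2

theorem isInvolutionProduct_triangular (x y : ℂˣ) (c p q : ℂ) :
    IsInvolutionProduct (AutP2 : Set BirP2) 8 (linearMap (triangularGL x y c p q)) := by
  have hy := y.ne_zero
  have h1 : IsInvolutionProduct (AutP2 : Set BirP2) 2 (linearMap (triangularGL 1 1 0 p q)) := by
    refine isInvolutionProduct_linearMap_two !![-1, 0, p; 0, -1, q; 0, 0, 1]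
      !![-1, 0, 0; 0, -1, 0; 0, 0, 1] ?_ ?_ ?_ <;>
    · ext i j; fin_cases i <;> fin_cases j <;> simp [Matrix.mul_apply, Fin.sum_univ_three,
        triangularGL, Matrix.GeneralLinearGroup.mkOfDetNeZero]
  have h2 : IsInvolutionProduct (AutP2 : Set BirP2) 2
      (linearMap (triangularGL 1 1 (c / y) 0 0)) := by
    refine isInvolutionProduct_linearMap_two !![-1, c / y, 0; 0, 1, 0; 0, 0, 1]
      !![-1, 0, 0; 0, 1, 0; 0, 0, 1] ?_ ?_ ?_ <;>
    · ext i j; fin_cases i <;> fin_cases j <;> simp [Matrix.mul_apply, Fin.sum_univ_three,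
        triangularGL, Matrix.GeneralLinearGroup.mkOfDetNeZero]
  have h3 : triangularGL x y c p q =
      triangularGL 1 1 0 p q * triangularGL 1 1 (c / y) 0 0 * triangularGL x y 0 0 0 := by
    ext i j
    fin_cases i <;> fin_cases j <;> simp [Matrix.mul_apply, Fin.sum_univ_three,
        triangularGL, Matrix.GeneralLinearGroup.mkOfDetNeZero]
  rw [h3, map_mul, map_mul]
  exact (h1.mul h2).mul (isInvolutionProduct_diagonal x y)

theorem isInvolutionProduct_affine (M : GL (Fin 3) ℂ) (a b c d p q : ℂ)
    (hM : M.1 = !![a, b, p; c, d, q; 0, 0, 1]) :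
    IsInvolutionProduct (AutP2 : Set BirP2) 8 (linearMap M) := by
  have hdet : a * d - b * c ≠ 0 := by
    have h := M.det.ne_zero
    rw [Matrix.GeneralLinearGroup.val_det_apply, hM] at h
    simpa [Matrix.det_fin_three] using h
  by_cases hc : c = 0
  · subst hc
    simp only [mul_zero, sub_zero] at hdet
    have : M = triangularGL (Units.mk0 a (left_ne_zero_of_mul hdet))
        (Units.mk0 d (right_ne_zero_of_mul hdet)) b p q := Units.ext hM
    rw [this]
    exact isInvolutionProduct_triangular _ _ _ _ _
  -- The quadratic equation says that (t, 1) is an eigenvector of the linear part; it becomes the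
  -- first basis vector in Q.
  obtain ⟨t, ht⟩ := exists_quadratic_eq_zero (b := d - a) (c := -b) hc
    (IsAlgClosed.exists_eq_mul_self _)
  have h1 : (c * t + d) * (a - t * c) ≠ 0 := by
    convert hdet using 1
    linear_combination -c * ht
  let Q : GL (Fin 3) ℂ := Matrix.GeneralLinearGroup.mkOfDetNeZero
    !![t, 1, 0; 1, 0, 0; 0, 0, 1] (by simp [Matrix.det_fin_three])
  have h2 : M * Q = Q * triangularGL (Units.mk0 _ (left_ne_zero_of_mul h1))
      (Units.mk0 _ (right_ne_zero_of_mul h1)) c q (p - t * q) := by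
    apply Units.ext
    rw [Units.val_mul, hM]
    ext i j
    fin_cases i <;> fin_cases j <;> simp [Matrix.mul_apply, Fin.sum_univ_three, Q,
        triangularGL, Matrix.GeneralLinearGroup.mkOfDetNeZero]
    linear_combination -ht
  rw [eq_mul_inv_of_mul_eq h2, map_mul, map_mul, map_inv]
  exact (isInvolutionProduct_triangular _ _ _ _ _).conj ⟨Q, rfl⟩

theorem IsAffineAut.isInvolutionProduct {φ : AutC2} (hφ : IsAffineAut φ) :
    IsInvolutionProduct (AutP2 : Set BirP2) 8 (toBir φ) := by
  obtain ⟨A, b, hA⟩ := hφ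
  let M : GL (Fin 3) ℂ := Matrix.GeneralLinearGroup.mkOfDetNeZero
    !![A.1 0 0, A.1 0 1, b 0; A.1 1 0, A.1 1 1, b 1; 0, 0, 1] (by
      have h := A.det.ne_zero
      rw [Matrix.GeneralLinearGroup.val_det_apply, Matrix.det_fin_two] at h
      simpa [Matrix.det_fin_three] using h)
  have h : toBir φ = linearMap M := by
    refine Units.ext (Quotient.sound (DominantTriple.equiv_of_dehom fun i => ?_))
    refine (congrFun φ.1.dehom_homog i).trans ?_
    rw [hA, hA]
    fin_cases i <;> simp [linearTriple, dehom, Fin.sum_univ_three, M,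
      Matrix.GeneralLinearGroup.mkOfDetNeZero, algebraMap_eq]
  rw [h]
  exact isInvolutionProduct_affine M _ _ _ _ _ _ rfl

end Projective

/-! ### De Jonquières maps as products of involutions -/

section DeJonquieres

theorem DominantTriple.equiv_of_dehom_mul {S T : DominantTriple}
    (h : ∀ i j, dehom (S.F i) * dehom (T.F j) = dehom (S.F j) * dehom (T.F i)) : S ≈ T := by
  intro i j
  have h1 : (S.F j * T.F i).IsHomogeneous (S.deg + T.deg) := (S.homog j).mul (T.homog i)
  apply sub_eq_zero.mp
  refine dehom_eq_zero (((S.homog i).mul (T.homog j)).sub h1) ?_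
  rw [map_sub, map_mul, map_mul, h, sub_self]

/-- The quadratic map `(α z₁ z₂ : β z₀ z₂ : z₀ z₁)`, that is, `(z₀, z₁) ⇢ (α / z₀, β / z₁)`. -/
noncomputable def quadraticTriple (α β : ℂˣ) : DominantTriple where
  F := ![C (α : ℂ) * X 1 * X 2, C (β : ℂ) * X 0 * X 2, X 0 * X 1]
  deg := 2
  homog i := by
    have hX := isHomogeneous_X (σ := Fin 3) ℂ
    have hC := isHomogeneous_C (R := ℂ) (Fin 3)
    fin_cases i
    · simpa using ((hC α).mul (hX 1)).mul (hX 2)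
    · simpa using ((hC β).mul (hX 0)).mul (hX 2)
    · simpa using (hX 0).mul (hX 1)
  dominant p k hp h := by
    set F : Fin 3 → MvPolynomial (Fin 3) ℂ :=
      ![C (α : ℂ) * X 1 * X 2, C (β : ℂ) * X 0 * X 2, X 0 * X 1] with hF
    have h1 := congrArg (bind₁ F) h
    -- Applied twice, the map is the identity up to the common factor α β z₀ z₁ z₂.
    have h2 : (fun i => bind₁ F (F i)) =
        fun i => (C (α : ℂ) * C (β : ℂ) * X 0 * X 1 * X 2) * X i := by
      funext i
      fin_cases i <;> simp [hF] <;> ring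
    rw [bind₁_bind₁, map_zero, h2, DominantTriple.bind₁_mul_left _ hp, bind₁_X_left,
      AlgHom.id_apply] at h1
    refine (mul_eq_zero.mp h1).resolve_left (pow_ne_zero _ ?_)
    have := X_ne_zero (σ := Fin 3) (R := ℂ)
    exact mul_ne_zero (mul_ne_zero (mul_ne_zero (mul_ne_zero (by simp) (by simp)) (this 0))
      (this 1)) (this 2)

/-- The rational map `(z₀, z₁) ⇢ (α / z₀, β / z₁)`. -/
noncomputable def quadraticMap (α β : ℂˣ) : DominantMap := Quotient.mk _ (quadraticTriple α β)

theorem quadraticMap_mul_self (α β : ℂˣ) : quadraticMap α β * quadraticMap α β = 1 := by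
  refine Quotient.sound fun i j => ?_
  have : ∀ i, ((quadraticTriple α β).comp (quadraticTriple α β)).F i =
      (C (α : ℂ) * C (β : ℂ) * X 0 * X 1 * X 2) * X i := fun i => by
    fin_cases i <;> simp [quadraticTriple, DominantTriple.comp] <;> ring
  rw [this, this, DominantTriple.id]
  ring

/-- The quadratic involution `(z₀, z₁) ⇢ (α / z₀, β / z₁)`. -/
noncomputable def quadraticInvolution (α β : ℂˣ) : BirP2 :=
  ⟨quadraticMap α β, quadraticMap α β, quadraticMap_mul_self α β, quadraticMap_mul_self α β⟩

theorem quadraticInvolution_mul_self (α β : ℂˣ) :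
    quadraticInvolution α β * quadraticInvolution α β = 1 :=
  Units.ext (quadraticMap_mul_self α β)

theorem quadraticInvolution_mem_J2 (α β : ℂˣ) : quadraticInvolution α β ∈ J2 := by
  refine ⟨quadraticTriple α β, rfl, 0, Polynomial.C (α : ℂ), 1, 0, 0, β, 1, 0, ?_, ?_, ?_, ?_⟩
  · simp
  · simp
  · simp [quadraticTriple, dehom, algebraMap_eq]
    ring
  · simp [quadraticTriple, dehom, algebraMap_eq]
    ring

theorem toBir_diagonal (α β : ℂˣ) :
    toBir (elementaryAut α β 0 0) = quadraticInvolution α β * quadraticInvolution 1 1 := by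
  refine Units.ext (Quotient.sound (DominantTriple.equiv_of_dehom_mul ?_))
  have h1 : ∀ i, dehom ((projTriple (elementaryAut α β 0 0)).F i) =
      (![C (α : ℂ) * X 0, C (β : ℂ) * X 1, 1] : Fin 3 → MvPolynomial (Fin 2) ℂ) i := fun i => by
    refine (congrFun (PolyMap.dehom_homog _) i).trans ?_
    fin_cases i <;> simp [elementaryAut, PolyMap.elementary]
  have h2 : ∀ i, dehom (((quadraticTriple α β).comp (quadraticTriple 1 1)).F i) =
      X 0 * X 1 * (![C (α : ℂ) * X 0, C (β : ℂ) * X 1, 1] : Fin 3 → MvPolynomial (Fin 2) ℂ) i :=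
    fun i => by
      fin_cases i <;> simp [quadraticTriple, DominantTriple.comp, dehom, algebraMap_eq] <;> ring
  intro i j
  rw [h1, h1]
  refine Eq.trans (congrArg _ (h2 j)) (Eq.trans ?_ (congrArg _ (h2 i)).symm)
  ring

theorem toBir_elementaryAut_mem_J2 (α β : ℂˣ) (γ : ℂ) (P : Polynomial ℂ) :
    toBir (elementaryAut α β γ P) ∈ J2 := by
  have h1 : ∀ i, dehom ((projTriple (elementaryAut α β γ P)).F i) =
      (![C (α : ℂ) * X 0 + Polynomial.aeval (X 1) P, C (β : ℂ) * X 1 + C γ, 1] :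
        Fin 3 → MvPolynomial (Fin 2) ℂ) i := fun i => by
    refine (congrFun (PolyMap.dehom_homog _) i).trans ?_
    fin_cases i <;> simp [elementaryAut, PolyMap.elementary]
  refine ⟨projTriple (elementaryAut α β γ P), rfl, Polynomial.C (α : ℂ), P, 0, 1, β, γ, 0, 1,
    ?_, ?_, ?_, ?_⟩
  · simp
  · simp
  · simp [h1, algebraMap_eq]
  · simp [h1]

/-- The translation is (z₀, γ - z₁) ∘ (z₀, -z₁), the shear (Q(z₁) - z₀, z₁) ∘ (-z₀, z₁), and the
diagonal part is (α/z₀, β/z₁) ∘ (1/z₀, 1/z₁). -/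
theorem isInvolutionProduct_toBir_elementaryAut (α β : ℂˣ) (γ : ℂ) (P : Polynomial ℂ) :
    IsInvolutionProduct J2 6 (toBir (elementaryAut α β γ P)) := by
  have key : ∀ (α β : ℂˣ) (γ : ℂ) (P : Polynomial ℂ),
      elementaryAut α β γ P * elementaryAut α β γ P = 1 →
      IsInvolutionProduct J2 1 (toBir (elementaryAut α β γ P)) := fun α β γ P h =>
    IsInvolutionProduct.of_mul_self (toBir_elementaryAut_mem_J2 α β γ P)
      (by rw [← map_mul, h, map_one])
  have key' : ∀ (α β : ℂˣ), IsInvolutionProduct J2 1 (quadraticInvolution α β) := fun α β =>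
    IsInvolutionProduct.of_mul_self (quadraticInvolution_mem_J2 α β)
      (quadraticInvolution_mul_self α β)
  -- The diagonal map is applied first, so P has to be read in the variable z₁/β.
  set Q := P.comp (Polynomial.C ((β⁻¹ : ℂˣ) : ℂ) * Polynomial.X) with hQ
  have h1 : elementaryAut α β γ P =
      elementaryAut 1 (-1) γ 0 * elementaryAut 1 (-1) 0 0 *
        (elementaryAut (-1) 1 0 Q * elementaryAut (-1) 1 0 0) * elementaryAut α β 0 0 := by
    simp only [elementaryAut_mul]
    congr 1
    · simp
    · simp
    · simp
    · simp [hQ, Polynomial.comp_assoc, ← mul_assoc, ← Polynomial.C_mul]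
  rw [h1, map_mul, map_mul, map_mul, map_mul, toBir_diagonal α β]
  refine IsInvolutionProduct.mul (m := 4) (n := 2) (IsInvolutionProduct.mul (m := 2) (n := 2)
    (IsInvolutionProduct.mul (m := 1) (n := 1) (key _ _ _ _ ?_) (key _ _ _ _ ?_))
    (IsInvolutionProduct.mul (m := 1) (n := 1) (key _ _ _ _ ?_) (key _ _ _ _ ?_)))
    (IsInvolutionProduct.mul (m := 1) (n := 1) (key' _ _) (key' _ _)) <;>
  · rw [elementaryAut_mul, ← elementaryAut_one]
    simp

theorem IsElementaryAut.isInvolutionProduct {φ : AutC2} (hφ : IsElementaryAut φ) :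
    IsInvolutionProduct J2 10 (toBir φ) := by
  obtain ⟨α, β, γ, P, rfl⟩ := hφ.exists_eq
  exact (isInvolutionProduct_toBir_elementaryAut α β γ P).mono le_rfl (by norm_num)

end DeJonquieres

/-! ### Generalized Hénon maps -/

section Henon

theorem toBir_injective : Function.Injective toBir := by
  refine (injective_iff_map_eq_one toBir).mpr fun φ hφ => ?_
  have h : projTriple φ ≈ DominantTriple.id := Quotient.exact (congrArg Units.val hφ)
  have hF := fun i => congrFun φ.1.dehom_homog i
  refine Units.ext (PolyMap.ext (funext fun i => ?_))
  have h2 : ∀ i : Fin 3, dehom ((projTriple φ).F i) = ![φ.1.f 0, φ.1.f 1, 1] i := hF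
  fin_cases i
  · have := congrArg dehom (h 0 2)
    rw [map_mul, map_mul, h2, h2] at this
    simpa [DominantTriple.id, dehom, PolyMap.one_f] using this
  · have := congrArg dehom (h 1 2)
    rw [map_mul, map_mul, h2, h2] at this
    simpa [DominantTriple.id, dehom, PolyMap.one_f] using this

theorem toBir_swapAut_mul_self : toBir swapAut * toBir swapAut = 1 := by
  rw [← map_mul, swapAut_mul_self, map_one]

variable {φ : AutC2} {P : Polynomial ℂ} {δ : ℂˣ}

theorem eq_swapAut_mul_elementaryAut (h0 : φ.1.f 0 = X 1)
    (h1 : φ.1.f 1 = Polynomial.aeval (X 1) P - C (δ : ℂ) * X 0) :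
    φ = swapAut * elementaryAut (-δ) 1 0 P := by
  refine Units.ext (PolyMap.ext (funext fun i => ?_))
  fin_cases i
  · refine h0.trans ((swapAut_mul_f_zero _).trans ?_).symm
    simp [elementaryAut, PolyMap.elementary]
  · refine h1.trans ((swapAut_mul_f_one _).trans ?_).symm
    simp [elementaryAut, PolyMap.elementary]
    ring

theorem jac_eq (h0 : φ.1.f 0 = X 1)
    (h1 : φ.1.f 1 = Polynomial.aeval (X 1) P - C (δ : ℂ) * X 0) : φ.1.jac = C (δ : ℂ) := by
  have h2 : pderiv 0 (Polynomial.aeval (X 1 : MvPolynomial (Fin 2) ℂ) P) = 0 := by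
    rw [Derivation.map_aeval, pderiv_X_of_ne (by decide), smul_zero]
  rw [PolyMap.jac, Matrix.det_fin_two]
  simp only [Matrix.of_apply, h0, h1, map_sub, h2, pderiv_C_mul, pderiv_X_self]
  simp

theorem IsHenonMap.invLength_toBir_of_jac_eq_one (hφ : IsHenonMap φ) (hj : φ.1.jac = 1) :
    invLength (toBir φ) toBir.range = 2 := by
  obtain ⟨P, δ, hP, hδ, h0, h1⟩ := hφ
  obtain ⟨δ, rfl⟩ : ∃ d : ℂˣ, δ = d := ⟨Units.mk0 δ hδ, rfl⟩
  rw [jac_eq h0 h1, ← C_1, C_inj, Units.val_eq_one] at hj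
  subst hj
  refine le_antisymm ?_ ?_
  · rw [eq_swapAut_mul_elementaryAut h0 h1, map_mul]
    refine IsInvolutionProduct.invLength_le (n := 2) (IsInvolutionProduct.mul (m := 1) (n := 1)
      (IsInvolutionProduct.of_mul_self ⟨_, rfl⟩ toBir_swapAut_mul_self)
      (IsInvolutionProduct.of_mul_self ⟨_, rfl⟩ ?_))
    rw [← map_mul, elementaryAut_mul, ← map_one toBir, ← elementaryAut_one]
    simp
  -- Neither the empty product nor a single involution can be φ. Comparing first components of φ² =
  -- 1 at z₀ = 0 would give P = 0.
  · have hsq : φ * φ ≠ 1 := by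
      intro h
      have h2 : (φ * φ).1.f 0 = X 0 := by rw [h]; rfl
      rw [Units.val_mul, PolyMap.mul_f, h0, bind₁_X_right, h1] at h2
      have h3 := congrArg (aeval ![(0 : Polynomial ℂ), Polynomial.X]) h2
      rw [map_sub, map_mul, ← Polynomial.aeval_algHom_apply, aeval_X, aeval_X] at h3
      simp at h3
      simp [h3] at hP
    refine le_sInf ?_
    rintro n ⟨l, hl, hprod, rfl⟩
    match l, hl, hprod with
    | [], _, hprod =>
      have h2 := toBir_injective (hprod.symm.trans (map_one toBir).symm)
      exact absurd (by rw [h2, one_mul]) hsq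
    | [s], hl, hprod =>
      have h2 : orderOf s = 2 := (hl s (by simp)).2
      rw [List.prod_singleton] at hprod
      have h3 := pow_orderOf_eq_one s
      rw [h2, pow_two, hprod, ← map_mul] at h3
      exact absurd (toBir_injective (h3.trans (map_one toBir).symm)) hsq
    | _ :: _ :: l, _, _ =>
      rw [List.length_cons, List.length_cons]
      exact_mod_cast Nat.le_add_left 2 l.length

theorem IsHenonMap.isInvolutionProduct (hφ : IsHenonMap φ) :
    IsInvolutionProduct Set.univ 11 (toBir φ) := by
  obtain ⟨P, δ, hP, hδ, h0, h1⟩ := hφ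
  obtain ⟨δ, rfl⟩ : ∃ d : ℂˣ, δ = d := ⟨Units.mk0 δ hδ, rfl⟩
  rw [eq_swapAut_mul_elementaryAut h0 h1, map_mul]
  exact IsInvolutionProduct.mul (m := 1) (n := 10)
    (IsInvolutionProduct.of_mul_self (Set.mem_univ _) toBir_swapAut_mul_self)
    ((isElementaryAut_elementaryAut _ _ _ _).isInvolutionProduct.mono (Set.subset_univ _) le_rfl)

end Henon

/-! ### The main theorem -/

theorem PolyMap.degree_pos (φ : AutC2) : 0 < φ.1.degree :=
  (PolyMap.totalDegree_pos φ 0).trans_le (le_max_left _ _)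

/-- Each reduction costs 8 + 10 = 18 and at least halves the degree; the last factor, of degree one,
is affine and costs 8. -/
theorem exists_isInvolutionProduct_toBir (φ : AutC2) :
    ∃ k, 2 ^ k ≤ φ.1.degree ∧ IsInvolutionProduct Set.univ (8 + 18 * k) (toBir φ) := by
  induction hn : φ.1.degree using Nat.strong_induction_on generalizing φ with
  | _ n ih =>
    rcases le_or_gt φ.1.degree 1 with h | h
    · exact ⟨0, by rw [pow_zero, ← hn]; exact PolyMap.degree_pos φ,
        (isAffineAut_of_degree_le_one h).isInvolutionProduct.mono (Set.subset_univ _) le_rfl⟩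
    obtain ⟨a, e, ψ, rfl, ha, he, -, hψ⟩ := exists_affine_mul_elementary_mul φ h
    have hpos := PolyMap.degree_pos ψ
    obtain ⟨k, hk, hk'⟩ := ih ψ.1.degree (by omega) ψ rfl
    refine ⟨k + 1, by rw [pow_succ]; omega, ?_⟩
    rw [map_mul, map_mul]
    exact (((ha.isInvolutionProduct.mono (Set.subset_univ _) le_rfl).mul
      (he.isInvolutionProduct.mono (Set.subset_univ _) le_rfl)).mul hk').mono le_rfl (by omega)

/-- A proper divisor of a prime is 1, so a single reduction leaves an affine map: 8 + 10 + 8 = 26.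
-/
theorem isInvolutionProduct_toBir_of_prime {φ : AutC2} (hφ : φ.1.degree.Prime) :
    IsInvolutionProduct Set.univ 26 (toBir φ) := by
  obtain ⟨a, e, ψ, h, ha, he, hdvd, hψ⟩ := exists_affine_mul_elementary_mul φ hφ.two_le
  have hpos := PolyMap.degree_pos ψ
  have h1 : ψ.1.degree = 1 := (hφ.eq_one_or_self_of_dvd _ hdvd).resolve_right (by omega)
  rw [h, map_mul, map_mul]
  exact ((ha.isInvolutionProduct.mono (Set.subset_univ _) le_rfl).mul
    (he.isInvolutionProduct.mono (Set.subset_univ _) le_rfl)).mul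
    ((isAffineAut_of_degree_le_one h1.le).isInvolutionProduct.mono (Set.subset_univ _) le_rfl)

theorem eight_mul_le_two_pow_add (k : ℕ) : 8 * k ≤ 2 ^ k + 16 := by
  rcases lt_or_ge k 3 with h | h
  · interval_cases k <;> norm_num
  · induction k, h using Nat.le_induction with
    | base => norm_num
    | succ k hk ih =>
      have := Nat.pow_le_pow_right (n := 2) (by norm_num) hk
      rw [pow_succ]
      omega

theorem mainTheorem2 (φ : AutC2) :
    (∃ n : ℕ, invLength (toBir φ) Set.univ = n ∧ (n : ℝ) ≤ 44 + 9 * (φ.1.degree : ℝ) / 4) ∧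
    (IsAffineAut φ → invLength (toBir φ) AutP2 ≤ 8) ∧
    (IsElementaryAut φ → invLength (toBir φ) J2 ≤ 10) ∧
    (IsHenonMap φ →
      (φ.1.jac = 1 → invLength (toBir φ) toBir.range = 2) ∧
      (φ.1.jac ≠ 1 → invLength (toBir φ) Set.univ ≤ 11)) ∧
    (φ.1.degree.Prime → invLength (toBir φ) Set.univ ≤ 26) := by
  refine ⟨?_, fun h => h.isInvolutionProduct.invLength_le,
    fun h => h.isInvolutionProduct.invLength_le,
    fun h => ⟨h.invLength_toBir_of_jac_eq_one, fun _ => h.isInvolutionProduct.invLength_le⟩,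
    fun h => (isInvolutionProduct_toBir_of_prime h).invLength_le⟩
  obtain ⟨k, hk, hφ⟩ := exists_isInvolutionProduct_toBir φ
  have h1 := hφ.invLength_le
  obtain ⟨n, hn⟩ := ENat.ne_top_iff_exists.mp (ne_top_of_le_ne_top (ENat.natCast_ne_top _) h1)
  refine ⟨n, hn.symm, ?_⟩
  rw [← hn] at h1
  have h2 : n ≤ 8 + 18 * k := by exact_mod_cast h1
  -- From 8k ≤ 2 ^ k + 16 ≤ d + 16 one gets 4(8 + 18k) = 32 + 9 · 8k ≤ 176 + 9d.
  have h3 : 4 * n ≤ 176 + 9 * φ.1.degree := by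
    have := eight_mul_le_two_pow_add k
    omega
  have h4 : (4 : ℝ) * n ≤ 176 + 9 * φ.1.degree := by exact_mod_cast h3
  linarith
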